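/- Let $\Omega\subset\mathbb R^2$ be a bounded polygonal domain (open, connected, $\Omega=\operatorname{int}\overline\Omega$, $\partial\Omega$ a finite union of segments). Let $\epsilon>0$ be a constant, let $\alpha$ be a measurable function with $0<\alpha_{\min}\le\alpha\le\alpha_{\max}$ a.e. in $\Omega$, and let $\bm f\in L^2(\Omega)^2$, $g\in L^2(\Omega)$, $k\ge 0$. Meshes. Let $\mathcal T_u$ be a finite partition of $\overline\Omega$ into polygons (with at least three vertices; hanging nodes count as vertices), each with a chosen interior point $\nu$, such that joining each $\nu$ to all vertices of its polygon $S(\nu)$ cuts $S(\nu)$ into nondegenerate triangles (one for each side of $S(\nu)$), and all these triangles form a conforming triangulation $\mathcal T_h$ of $\overline\Omega$. Let $\mathcal F_u$ be the set of primal edges (sides of the polygons), $\mathcal F_u^0$ the set of those not contained in $\partial\Omega$, and $\mathcal F_p$ the set of dual edges (segments from a point $\nu$ to a vertex of $S(\nu)$). On each edge $e$ fix a unit normal $\bm n$, pointing out of $\Omega$ if $e\subset\partial\Omega$, and let $\bm t$ be the corresponding unit tangent. If $\tau_i\in\mathcal T_h$ are the (one or two) triangles that have the edge $e$, with outward unit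 normals $\bm n_i$ on $e$, and $\phi_i$ is the trace of $\phi|_{\tau_i}$ on $e$, the jump is $[\phi]=\sum_i(\bm n_i\cdot\bm n)\,\phi_i$. The element-wise gradient and (row-wise) divergence are $\nabla_h$ and $\mathrm{div}_h$, with $(\nabla \bm v)_{ij}=\partial_j v_i$, and $(\cdot,\cdot)$ is the $L^2(\Omega)$ inner product. Spaces. With $P^k$ the polynomials of degree at most $k$, let $$U^h=\{\bm v:\ \bm v|_\tau\in P^k(\tau)^2\ \forall\tau\in\mathcal T_h,\ \bm v\cdot\bm n\text{ continuous over each }e\in\mathcal F_p\},$$ $$W^h=\{G:\ G|_\tau\in P^k(\tau)^{2\times2}\ \forall\tau\in\mathcal T_h,\ G\bm n\text{ continuous over each }e\in\mathcal F_u^0\},$$ $$P^h=\{q:\ q|_\tau\in P^k(\tau)\ \forall\tau\in\mathcal T_h,\ q\text{ continuous over each }e\in\mathcal F_u^0,\ \textstyle\int_\Omega q\,dx=0\},$$ $$\widehat U^h=\{\widehat{\bm v}:\ \widehat{\bm v}|_e\in P^k(e)^2,\ \widehat{\bm v}\cdot\bm n|_e=0\ \forall e\in\mathcal F_p\}.$$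 Bilinear forms. Let $$B_h^*(\bm v,G)=-\int_\Omega\bm v\cdot\mathrm{div}_hG\,dx+\sum_{e\in\mathcal F_p}\int_e(\bm v\cdot\bm n)\,\bm n\cdot[G\bm n]\,ds,$$ $$B_h(G,\bm v)=\int_\Omega G:\nabla_h\bm v\,dx-\sum_{e\in\mathcal F_u}\int_e[\bm v]\cdot(G\bm n)\,ds-\sum_{e\in\mathcal F_p}\int_e[(\bm v\cdot\bm t)\,\bm t\cdot(G\bm n)]\,ds,$$ $$T_h^*(\widehat{\bm v},G)=T_h(G,\widehat{\bm v})=\sum_{e\in\mathcal F_p}\int_e[G\bm n]\cdot\widehat{\bm v}\,ds,$$ $$b_h^*(q,\bm v)=-\int_\Omega q\,\mathrm{div}_h\bm v\,dx+\sum_{e\in\mathcal F_u}\int_e q\,[\bm v\cdot\bm n]\,ds,\qquad b_h(\bm v,q)=\int_\Omega\bm v\cdot\nabla_hq\,dx-\sum_{e\in\mathcal F_p}\int_e(\bm v\cdot\bm n)\,[q]\,ds.$$ Theorem (existence and uniqueness). There is exactly one $(L_h,\bm u_h,\widehat{\bm u}_h,p_h)\in W^h\times U^h\times\widehat U^h\times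 P^h$ such that $$\begin{aligned}(L_h,G)&=\sqrt\epsilon\,B_h^*(\bm u_h,G)+\sqrt\epsilon\,T_h^*(\widehat{\bm u}_h,G)&&\forall G\in W^h,\\ \sqrt\epsilon\,B_h(L_h,\bm v)+(\alpha\bm u_h,\bm v)+b_h^*(p_h,\bm v)&=(\bm f,\bm v)&&\forall\bm v\in U^h,\\ -b_h(\bm u_h,q)&=(g,q)&&\forall q\in P^h,\\ T_h(L_h,\widehat{\bm v})&=0&&\forall\widehat{\bm v}\in\widehat U^h.\end{aligned}$$ -/

import Mathlib

open MeasureTheory Matrix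

noncomputable section

namespace SDG

/-- The Euclidean plane. -/
abbrev Plane : Type := EuclideanSpace ℝ (Fin 2)

/-- Polynomials in the two coordinates. A polynomial function on a nondegenerate triangle is
represented by the unique polynomial that induces it. -/
abbrev Poly : Type := MvPolynomial (Fin 2) ℝ

/-! ### Plane geometry -/

/-- The outward unit normal, on the edge with endpoints `a`, `b`, of the triangle `a b c`. -/
def outwardNormal (a b c : Plane) : Fin 2 → ℝ :=
  let m : Fin 2 → ℝ := (dist a b)⁻¹ • ![(b - a) 1, -((b - a) 0)]
  if m ⬝ᵥ (c - a).ofLp < 0 then m else -m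

/-- `n` is one of the two unit normals of the segment with endpoints `a`, `b`. -/
def IsUnitNormal (n : Fin 2 → ℝ) (a b : Plane) : Prop :=
  n ⬝ᵥ n = 1 ∧ n ⬝ᵥ (b - a).ofLp = 0

/-- The unit tangent vector that corresponds to a unit normal. -/
def tangent (n : Fin 2 → ℝ) : Fin 2 → ℝ := ![-(n 1), n 0]

/-- An edge, given by its two endpoints, as a subset of the plane. -/
def edgeSet (e : Sym2 Plane) : Set Plane := convexHull ℝ {x | x ∈ e}

/-- `∫_{[a,b]} φ ds`, by the constant speed parametrization of the segment. -/
def segIntegral (φ : Plane → ℝ) (a b : Plane) : ℝ :=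
  dist a b * ∫ s in (0 : ℝ)..1, φ (AffineMap.lineMap a b s)

theorem segIntegral_symm (φ : Plane → ℝ) (a b : Plane) :
    segIntegral φ a b = segIntegral φ b a := by
  unfold segIntegral
  rw [dist_comm]
  congr 1
  have h := intervalIntegral.integral_comp_sub_left (a := (0 : ℝ)) (b := 1)
    (fun s => φ (AffineMap.lineMap b a s)) 1
  simpa [AffineMap.lineMap_apply_one_sub] using h

/-- The integral `∫_e φ ds` with respect to arc length over an edge. -/
def edgeIntegral (e : Sym2 Plane) (φ : Plane → ℝ) : ℝ :=
  Sym2.lift ⟨segIntegral φ, segIntegral_symm φ⟩ e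

/-- The affine parameter of a point `x` of the segment from `a` to `b`:
it is `0` at `a` and `1` at `b`. -/
def edgeParam (a b x : Plane) : ℝ := inner ℝ (x - a) (b - a) / ‖b - a‖ ^ 2

/-- A bounded polygonal domain: open, connected, bounded, equal to the interior of its closure
(no slits), with boundary a finite union of segments. -/
structure IsPolygonalDomain (Ω : Set Plane) : Prop where
  isOpen : IsOpen Ω
  isConnected : IsConnected Ω
  isBounded : Bornology.IsBounded Ω
  interior_closure : interior (closure Ω) = Ω
  polygonal : ∃ s : Finset (Sym2 Plane), frontier Ω = ⋃ e ∈ s, edgeSet e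

/-! ### Meshes -/

/-- A primal polygonal mesh of `Ω`, with an interior point in each cell. The cell `c` is a polygon
with the vertices `vertex c 0, …, vertex c (sides c - 1)` in cyclic order (hanging nodes count as
vertices; angles of 180 degrees are allowed), and it is cut into triangles by joining its interior
point `center c` to all its vertices. The resulting triangles form a conforming triangulation of
`closure Ω`. -/
structure Mesh (Ω : Set Plane) where
  /-- the primal cells -/
  Cell : Type
  /-- there are finitely many cells -/
  [fintypeCell : Fintype Cell]
  /-- the number of vertices of a cell -/
  sides : Cell → ℕ
  three_le_sides : ∀ c, 3 ≤ sides c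
  /-- the vertices of a cell, in cyclic order -/
  vertex : (c : Cell) → Fin (sides c) → Plane
  vertex_injective : ∀ c, Function.Injective (vertex c)
  /-- the interior point of a cell -/
  center : Cell → Plane
  nondegenerate : ∀ c i,
    AffineIndependent ℝ ![center c, vertex c i, vertex c (finRotate _ i)]
  center_mem_interior : ∀ c, center c ∈ interior
    (⋃ i, convexHull ℝ {center c, vertex c i, vertex c (finRotate _ i)})
  /-- distinct triangles do not overlap -/
  disjoint_interior : ∀ τ τ' : (Σ c, Fin (sides c)), τ ≠ τ' → Disjoint
    (interior (convexHull ℝ {center τ.1, vertex τ.1 τ.2, vertex τ.1 (finRotate _ τ.2)}))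
    (interior (convexHull ℝ {center τ'.1, vertex τ'.1 τ'.2, vertex τ'.1 (finRotate _ τ'.2)}))
  /-- distinct triangles meet in a common vertex, a common edge, or not at all -/
  conforming : ∀ τ τ' : (Σ c, Fin (sides c)), τ ≠ τ' →
    convexHull ℝ {center τ.1, vertex τ.1 τ.2, vertex τ.1 (finRotate _ τ.2)} ∩
      convexHull ℝ {center τ'.1, vertex τ'.1 τ'.2, vertex τ'.1 (finRotate _ τ'.2)} ⊆
    convexHull ℝ (({center τ.1, vertex τ.1 τ.2, vertex τ.1 (finRotate _ τ.2)} : Set Plane) ∩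
      {center τ'.1, vertex τ'.1 τ'.2, vertex τ'.1 (finRotate _ τ'.2)})
  cover : ⋃ τ : (Σ c, Fin (sides c)),
    convexHull ℝ {center τ.1, vertex τ.1 τ.2, vertex τ.1 (finRotate _ τ.2)} = closure Ω

attribute [instance] Mesh.fintypeCell

namespace Mesh

variable {Ω : Set Plane} (M : Mesh Ω)

/-- The triangles of the simplicial submesh: `⟨c, i⟩` is the triangle spanned by the interior
point of the cell `c` and the `i`-th side of `c`. -/
abbrev Tri : Type := Σ c, Fin (M.sides c)

/-- The dual edges: `⟨c, i⟩` joins the interior point of the cell `c` to the `i`-th vertex of `c`. -/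
abbrev DualEdge : Type := Σ c, Fin (M.sides c)

/-- The first endpoint of the primal edge of a triangle. -/
def fst (τ : M.Tri) : Plane := M.vertex τ.1 τ.2

/-- The second endpoint of the primal edge of a triangle. -/
def snd (τ : M.Tri) : Plane := M.vertex τ.1 (finRotate _ τ.2)

/-- A triangle as a closed subset of the plane. -/
def triSet (τ : M.Tri) : Set Plane := convexHull ℝ {M.center τ.1, M.fst τ, M.snd τ}

/-- The set of primal edges: a primal edge is a side of a cell. A side shared by two cells is
one edge. -/
abbrev PrimalEdge : Type :=
  {e : Sym2 Plane // ∃ τ : M.Tri, s(M.fst τ, M.snd τ) = e}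

instance : Finite M.PrimalEdge :=
  (Set.finite_range fun τ : M.Tri => s(M.fst τ, M.snd τ)).to_subtype

instance : Fintype M.PrimalEdge := Fintype.ofFinite _

/-- The primal edge of a triangle. -/
def primalEdge (τ : M.Tri) : M.PrimalEdge := ⟨s(M.fst τ, M.snd τ), τ, rfl⟩

/-- Some triangle that has the given primal edge. It is used to evaluate on the edge those
quantities that take the same value from all sides of the edge. -/
def side (e : M.PrimalEdge) : M.Tri := e.2.choose

/-- A primal edge is interior if it does not lie on the boundary of `Ω`. -/
def IsInteriorEdge (e : M.PrimalEdge) : Prop := ¬ edgeSet e.1 ⊆ frontier Ω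

/-- The segment of a dual edge. -/
def dualSym (e : M.DualEdge) : Sym2 Plane := s(M.center e.1, M.vertex e.1 e.2)

/-- One of the two triangles that share the dual edge `e`. -/
def after (e : M.DualEdge) : M.Tri := e

/-- The other triangle that shares the dual edge `e`. -/
def before (e : M.DualEdge) : M.Tri := ⟨e.1, (finRotate _).symm e.2⟩

/-- The outward unit normal of a triangle on its primal edge. -/
def normalPrimal (τ : M.Tri) : Fin 2 → ℝ := outwardNormal (M.fst τ) (M.snd τ) (M.center τ.1)

/-- The outward unit normal of the triangle `after e` on its edge `e`. -/
def normalAfter (e : M.DualEdge) : Fin 2 → ℝ :=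
  outwardNormal (M.center e.1) (M.vertex e.1 e.2) (M.vertex e.1 (finRotate _ e.2))

/-- The outward unit normal of the triangle `before e` on its edge `e`. -/
def normalBefore (e : M.DualEdge) : Fin 2 → ℝ :=
  outwardNormal (M.center e.1) (M.vertex e.1 e.2) (M.vertex e.1 ((finRotate _).symm e.2))

/-- A choice of a unit normal on every edge, pointing out of `Ω` on the boundary edges. -/
structure EdgeNormals where
  /-- the normals on the primal edges -/
  primal : M.PrimalEdge → Fin 2 → ℝ
  /-- the normals on the dual edges -/
  dual : M.DualEdge → Fin 2 → ℝ
  primal_isUnitNormal : ∀ τ, IsUnitNormal (primal (M.primalEdge τ)) (M.fst τ) (M.snd τ)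
  dual_isUnitNormal : ∀ e, IsUnitNormal (dual e) (M.center e.1) (M.vertex e.1 e.2)
  primal_outward : ∀ τ, ¬ M.IsInteriorEdge (M.primalEdge τ) →
    primal (M.primalEdge τ) = M.normalPrimal τ

/-! ### Piecewise polynomials -/

/-- Scalar piecewise polynomials: one polynomial on each triangle. -/
abbrev ScalarField : Type := M.Tri → Poly

/-- Vector valued piecewise polynomials. -/
abbrev VectorField : Type := M.Tri → Fin 2 → Poly

/-- Matrix valued piecewise polynomials. -/
abbrev TensorField : Type := M.Tri → Matrix (Fin 2) (Fin 2) Poly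

/-- Vector valued piecewise polynomials on the dual edges. On each edge each component is a
polynomial in the affine parameter of the edge. -/
abbrev EdgeField : Type := M.DualEdge → Fin 2 → Polynomial ℝ

end Mesh

/-- The value of a polynomial at a point of the plane. -/
def val (p : Poly) (x : Plane) : ℝ := MvPolynomial.eval x.ofLp p

/-- The value of a vector of polynomials. -/
def vval (v : Fin 2 → Poly) (x : Plane) : Fin 2 → ℝ := fun i => val (v i) x

/-- The value of a matrix of polynomials. -/
def mval (G : Matrix (Fin 2) (Fin 2) Poly) (x : Plane) : Matrix (Fin 2) (Fin 2) ℝ :=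
  Matrix.of fun i j => val (G i j) x

/-- The gradient of a scalar polynomial. -/
def grad (q : Poly) : Fin 2 → Poly := fun j => MvPolynomial.pderiv j q

/-- The gradient of a vector polynomial, `(∇v)_{ij} = ∂_j v_i`. -/
def vgrad (v : Fin 2 → Poly) : Matrix (Fin 2) (Fin 2) Poly :=
  Matrix.of fun i j => MvPolynomial.pderiv j (v i)

/-- The divergence of a vector polynomial. -/
def dvg (v : Fin 2 → Poly) : Poly := ∑ j, MvPolynomial.pderiv j (v j)

/-- The row-wise divergence of a matrix polynomial. -/
def mdvg (G : Matrix (Fin 2) (Fin 2) Poly) : Fin 2 → Poly :=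
  fun i => ∑ j, MvPolynomial.pderiv j (G i j)

/-- The product `A : B = ∑ A_{ij} B_{ij}`. -/
def ddot (A B : Matrix (Fin 2) (Fin 2) ℝ) : ℝ := ∑ i, ∑ j, A i j * B i j

namespace Mesh

variable {Ω : Set Plane} (M : Mesh Ω)

/-- The value of an edge field at a point of the dual edge `e`. -/
def eval (w : M.EdgeField) (e : M.DualEdge) (x : Plane) : Fin 2 → ℝ :=
  fun i => (w e i).eval (edgeParam (M.center e.1) (M.vertex e.1 e.2) x)

/-- The integral over `Ω` of a function that is given triangle by triangle. -/
def integral (φ : M.Tri → Plane → ℝ) : ℝ := ∑ τ, ∫ x in M.triSet τ, φ τ x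

/-- The integral `∑_{e ∈ F_u} ∫_e φ_e ds`. -/
def primalIntegral (φ : M.PrimalEdge → Plane → ℝ) : ℝ := ∑ e, edgeIntegral e.1 (φ e)

/-- The integral `∑_{e ∈ F_p} ∫_e φ_e ds`. -/
def dualIntegral (φ : M.DualEdge → Plane → ℝ) : ℝ := ∑ e, edgeIntegral (M.dualSym e) (φ e)

namespace EdgeNormals

variable {M} (N : M.EdgeNormals)

open Classical in
/-- The jump `∑ δ_i φ_i` on a primal edge, over the (one or two) triangles that have this edge;
`δ_i` is the product of the outward normal of the triangle and the fixed normal of the edge. -/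
def jumpPrimal {V : Type} [AddCommGroup V] [Module ℝ V] (φ : M.Tri → V) (e : M.PrimalEdge) : V :=
  ∑ τ : M.Tri with M.primalEdge τ = e, (M.normalPrimal τ ⬝ᵥ N.primal e) • φ τ

/-- The jump `δ_1 φ_1 + δ_2 φ_2` on a dual edge. -/
def jumpDual {V : Type} [AddCommGroup V] [Module ℝ V] (φ : M.Tri → V) (e : M.DualEdge) : V :=
  (M.normalBefore e ⬝ᵥ N.dual e) • φ (M.before e) + (M.normalAfter e ⬝ᵥ N.dual e) • φ (M.after e)

/-! ### The finite element spaces -/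

/-- The velocity space `U^h`. -/
def velocitySpace (k : ℕ) : Submodule ℝ M.VectorField where
  carrier := {v | (∀ τ i, v τ i ∈ MvPolynomial.restrictTotalDegree (Fin 2) ℝ k) ∧
    ∀ e : M.DualEdge, ∀ x ∈ edgeSet (M.dualSym e),
      vval (v (M.before e)) x ⬝ᵥ N.dual e = vval (v (M.after e)) x ⬝ᵥ N.dual e}
  add_mem' := by
    rintro v w ⟨hv, hv'⟩ ⟨hw, hw'⟩
    refine ⟨fun τ i => Submodule.add_mem _ (hv τ i) (hw τ i), fun e x hx => ?_⟩
    have h1 := hv' e x hx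
    have h2 := hw' e x hx
    simp only [vval, val, dotProduct, Fin.sum_univ_two, Pi.add_apply, map_add] at h1 h2 ⊢
    linear_combination h1 + h2
  zero_mem' := by
    refine ⟨fun τ i => Submodule.zero_mem _, fun e x hx => ?_⟩
    simp [vval, val]
  smul_mem' := by
    rintro a v ⟨hv, hv'⟩
    refine ⟨fun τ i => Submodule.smul_mem _ a (hv τ i), fun e x hx => ?_⟩
    have h1 := hv' e x hx
    simp only [vval, val, dotProduct, Fin.sum_univ_two, Pi.smul_apply,
      MvPolynomial.smul_eval] at h1 ⊢
    linear_combination a * h1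

/-- The velocity gradient space `W^h`. -/
def gradientSpace (k : ℕ) : Submodule ℝ M.TensorField where
  carrier := {G | (∀ τ i j, G τ i j ∈ MvPolynomial.restrictTotalDegree (Fin 2) ℝ k) ∧
    ∀ e : M.PrimalEdge, M.IsInteriorEdge e →
      ∀ τ τ', M.primalEdge τ = e → M.primalEdge τ' = e → ∀ x ∈ edgeSet e.1,
        mval (G τ) x *ᵥ N.primal e = mval (G τ') x *ᵥ N.primal e}
  add_mem' := by
    rintro G H ⟨hG, hG'⟩ ⟨hH, hH'⟩
    refine ⟨fun τ i j => Submodule.add_mem _ (hG τ i j) (hH τ i j),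
      fun e he τ τ' hτ hτ' x hx => ?_⟩
    have h1 := hG' e he τ τ' hτ hτ' x hx
    have h2 := hH' e he τ τ' hτ hτ' x hx
    funext i
    have h1 := congrFun h1 i
    have h2 := congrFun h2 i
    simp only [mval, val, mulVec, dotProduct, Fin.sum_univ_two, Pi.add_apply, Matrix.add_apply,
      Matrix.of_apply, map_add] at h1 h2 ⊢
    linear_combination h1 + h2
  zero_mem' := by
    refine ⟨fun τ i j => Submodule.zero_mem _, fun e he τ τ' hτ hτ' x hx => ?_⟩
    simp [mval, val]
  smul_mem' := by
    rintro a G ⟨hG, hG'⟩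
    refine ⟨fun τ i j => Submodule.smul_mem _ a (hG τ i j), fun e he τ τ' hτ hτ' x hx => ?_⟩
    have h1 := hG' e he τ τ' hτ hτ' x hx
    funext i
    have h1 := congrFun h1 i
    simp only [mval, val, mulVec, dotProduct, Fin.sum_univ_two, Pi.smul_apply, Matrix.smul_apply,
      Matrix.of_apply, MvPolynomial.smul_eval] at h1 ⊢
    linear_combination a * h1

/-- The space `Û^h` of tangential vector fields on the dual edges. -/
def traceSpace (k : ℕ) : Submodule ℝ M.EdgeField where
  carrier := {w | (∀ e i, w e i ∈ Polynomial.degreeLE ℝ k) ∧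
    ∀ e : M.DualEdge, ∀ x ∈ edgeSet (M.dualSym e), M.eval w e x ⬝ᵥ N.dual e = 0}
  add_mem' := by
    rintro v w ⟨hv, hv'⟩ ⟨hw, hw'⟩
    refine ⟨fun e i => Submodule.add_mem _ (hv e i) (hw e i), fun e x hx => ?_⟩
    have h1 := hv' e x hx
    have h2 := hw' e x hx
    simp only [Mesh.eval, dotProduct, Fin.sum_univ_two, Pi.add_apply,
      Polynomial.eval_add] at h1 h2 ⊢
    linear_combination h1 + h2
  zero_mem' := by
    refine ⟨fun e i => Submodule.zero_mem _, fun e x hx => ?_⟩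
    simp [Mesh.eval, dotProduct]
  smul_mem' := by
    rintro a v ⟨hv, hv'⟩
    refine ⟨fun e i => Submodule.smul_mem _ a (hv e i), fun e x hx => ?_⟩
    have h1 := hv' e x hx
    simp only [Mesh.eval, dotProduct, Fin.sum_univ_two, Pi.smul_apply,
      Polynomial.eval_smul, smul_eq_mul] at h1 ⊢
    linear_combination a * h1

end EdgeNormals

theorem integrableOn_val (p : Poly) (τ : M.Tri) :
    IntegrableOn (fun x => val p x) (M.triSet τ) := by
  have hc : Continuous fun x : Plane => val p x :=
    (MvPolynomial.continuous_eval p).comp (PiLp.continuous_ofLp 2 _)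
  have hK : IsCompact (M.triSet τ) :=
    (Set.toFinite {M.center τ.1, M.fst τ, M.snd τ}).isCompact_convexHull (𝕜 := ℝ)
  exact hc.continuousOn.integrableOn_compact hK

/-- The pressure space `P^h`. -/
def pressureSpace (k : ℕ) : Submodule ℝ M.ScalarField where
  carrier := {q | (∀ τ, q τ ∈ MvPolynomial.restrictTotalDegree (Fin 2) ℝ k) ∧
    (∀ e : M.PrimalEdge, M.IsInteriorEdge e →
      ∀ τ τ', M.primalEdge τ = e → M.primalEdge τ' = e → ∀ x ∈ edgeSet e.1,
        val (q τ) x = val (q τ') x) ∧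
    M.integral (fun τ x => val (q τ) x) = 0}
  add_mem' := by
    rintro q r ⟨hq, hq', hq''⟩ ⟨hr, hr', hr''⟩
    refine ⟨fun τ => Submodule.add_mem _ (hq τ) (hr τ), fun e he τ τ' hτ hτ' x hx => ?_, ?_⟩
    · have h1 := hq' e he τ τ' hτ hτ' x hx
      have h2 := hr' e he τ τ' hτ hτ' x hx
      simp only [val, Pi.add_apply, map_add] at h1 h2 ⊢
      rw [h1, h2]
    · have h : M.integral (fun τ x => val ((q + r) τ) x) =
          M.integral (fun τ x => val (q τ) x) + M.integral (fun τ x => val (r τ) x) := by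
        unfold integral
        rw [← Finset.sum_add_distrib]
        refine Finset.sum_congr rfl fun τ _ => ?_
        rw [← integral_add (M.integrableOn_val _ τ) (M.integrableOn_val _ τ)]
        simp [val]
      rw [h, hq'', hr'', add_zero]
  zero_mem' := by
    refine ⟨fun τ => Submodule.zero_mem _, fun e he τ τ' hτ hτ' x hx => ?_, ?_⟩
    · simp [val]
    · simp [integral, val]
  smul_mem' := by
    rintro a q ⟨hq, hq', hq''⟩
    refine ⟨fun τ => Submodule.smul_mem _ a (hq τ), fun e he τ τ' hτ hτ' x hx => ?_, ?_⟩
    · have h1 := hq' e he τ τ' hτ hτ' x hx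
      simp only [val, Pi.smul_apply, MvPolynomial.smul_eval] at h1 ⊢
      rw [h1]
    · have h : M.integral (fun τ x => val ((a • q) τ) x) =
          a * M.integral (fun τ x => val (q τ) x) := by
        unfold integral
        rw [Finset.mul_sum]
        refine Finset.sum_congr rfl fun τ _ => ?_
        rw [← integral_const_mul]
        simp [val]
      rw [h, hq'', mul_zero]

namespace EdgeNormals

variable {M} (N : M.EdgeNormals)

/-! ### The bilinear forms -/

/-- `B_h^*(v, G) = -∫ v · div_h G + ∑_{F_p} ∫_e (v · n) n · [G n]`. -/
def formBstar (v : M.VectorField) (G : M.TensorField) : ℝ :=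
  -M.integral (fun τ x => vval (v τ) x ⬝ᵥ vval (mdvg (G τ)) x) +
    M.dualIntegral (fun e x => (vval (v (M.after e)) x ⬝ᵥ N.dual e) *
      (N.dual e ⬝ᵥ N.jumpDual (fun τ => mval (G τ) x *ᵥ N.dual e) e))

/-- `B_h(G, v) = ∫ G : ∇_h v - ∑_{F_u} ∫_e [v] · (G n) - ∑_{F_p} ∫_e [(v · t) t · (G n)]`. -/
def formB (G : M.TensorField) (v : M.VectorField) : ℝ :=
  M.integral (fun τ x => ddot (mval (G τ) x) (mval (vgrad (v τ)) x)) -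
    M.primalIntegral (fun e x => N.jumpPrimal (fun τ => vval (v τ) x) e ⬝ᵥ
      (mval (G (M.side e)) x *ᵥ N.primal e)) -
    M.dualIntegral (fun e x => N.jumpDual (fun τ => (vval (v τ) x ⬝ᵥ tangent (N.dual e)) *
      (tangent (N.dual e) ⬝ᵥ (mval (G τ) x *ᵥ N.dual e))) e)

/-- `T_h^*(w, G) = ∑_{F_p} ∫_e w · [G n]`. -/
def formTstar (w : M.EdgeField) (G : M.TensorField) : ℝ :=
  M.dualIntegral (fun e x =>
    M.eval w e x ⬝ᵥ N.jumpDual (fun τ => mval (G τ) x *ᵥ N.dual e) e)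

/-- `T_h(G, w) = ∑_{F_p} ∫_e [G n] · w`. -/
def formT (G : M.TensorField) (w : M.EdgeField) : ℝ :=
  M.dualIntegral (fun e x =>
    N.jumpDual (fun τ => mval (G τ) x *ᵥ N.dual e) e ⬝ᵥ M.eval w e x)

/-- `b_h^*(q, v) = -∫ q div_h v + ∑_{F_u} ∫_e q [v · n]`. -/
def formbstar (q : M.ScalarField) (v : M.VectorField) : ℝ :=
  -M.integral (fun τ x => val (q τ) x * val (dvg (v τ)) x) +
    M.primalIntegral (fun e x => val (q (M.side e)) x *
      N.jumpPrimal (fun τ => vval (v τ) x ⬝ᵥ N.primal e) e)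

/-- `b_h(v, q) = ∫ v · ∇_h q - ∑_{F_p} ∫_e (v · n) [q]`. -/
def formb (v : M.VectorField) (q : M.ScalarField) : ℝ :=
  M.integral (fun τ x => vval (v τ) x ⬝ᵥ vval (grad (q τ)) x) -
    M.dualIntegral (fun e x => (vval (v (M.after e)) x ⬝ᵥ N.dual e) *
      N.jumpDual (fun τ => val (q τ) x) e)

/-- The discrete system for `(L, u, w, p) ∈ W^h × U^h × Û^h × P^h`. -/
structure IsSolution (k : ℕ) (ε : ℝ) (α : Plane → ℝ) (f : Plane → Fin 2 → ℝ) (g : Plane → ℝ)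
    (L : N.gradientSpace k) (u : N.velocitySpace k) (w : N.traceSpace k)
    (p : M.pressureSpace k) : Prop where
  eq_gradient : ∀ G : N.gradientSpace k,
    M.integral (fun τ x => ddot (mval (L.1 τ) x) (mval (G.1 τ) x)) =
      √ε * N.formBstar u G + √ε * N.formTstar w G
  eq_momentum : ∀ v : N.velocitySpace k,
    √ε * N.formB L v + M.integral (fun τ x => (α x • vval (u.1 τ) x) ⬝ᵥ vval (v.1 τ) x) +
      N.formbstar p v = M.integral (fun τ x => f x ⬝ᵥ vval (v.1 τ) x)
  eq_mass : ∀ q : M.pressureSpace k,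
    -N.formb u q = M.integral (fun τ x => g x * val (q.1 τ) x)
  eq_trace : ∀ z : N.traceSpace k, N.formT L z = 0

end EdgeNormals

end Mesh

end SDG

end

/-!
The system is a saddle point problem in finite dimension. The three pairs of forms are adjoint to
each other, by the divergence theorem on every triangle, so that testing the homogeneous system
with its own solution gives `‖L‖² + (α u, u) = 0`, hence `L = 0` and `u = 0`. What remains is that
`T_h^*(w, ·)` and `b_h(·, p)` determine `w` and `p`. A tensor field in `W^h` can be chosen with
vanishing normal components on the primal edges and any prescribed tangential jump on the dual
edges, which gives `w = 0`. A velocity in `U^h` without flux through the dual edges can be chosen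
such that its product with `∇_h p` is a sum of squares with nonnegative weights, which makes `p`
constant on every triangle. Fluxes through the dual edges then remove the jumps within a cell,
continuity over the interior primal edges and the connectedness of `Ω` make `p` globally constant,
and `p = 0` because its integral vanishes.
-/

noncomputable section

namespace SDG

/-! ### Triangles in the plane -/

theorem plane_ext {x y : Plane} (h0 : x 0 = y 0) (h1 : x 1 = y 1) : x = y := by
  ext i; fin_cases i <;> assumption

/-- Twice the signed area of the triangle `a b c`. -/
def triDet (a b c : Plane) : ℝ :=
  (b 0 - a 0) * (c 1 - a 1) - (b 1 - a 1) * (c 0 - a 0)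

theorem triDet_swap (a b c : Plane) : triDet a c b = -triDet a b c := by
  unfold triDet; ring

theorem triDet_rotate (a b c : Plane) : triDet b c a = triDet a b c := by
  unfold triDet; ring

theorem triDet_eq_tangent_dotProduct (a b c : Plane) :
    triDet a b c = tangent (b - a).ofLp ⬝ᵥ (c - a).ofLp := by
  simp [triDet, tangent, dotProduct, Fin.sum_univ_two]; ring

theorem ne_of_triDet_ne_zero {a b c : Plane} (h : triDet a b c ≠ 0) : a ≠ b := by
  rintro rfl; simp [triDet] at h

theorem triDet_ne_zero {a b c : Plane} (h : AffineIndependent ℝ ![a, b, c]) :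
    triDet a b c ≠ 0 := by
  rw [affineIndependent_iff_linearIndependent_vsub ℝ _ (0 : Fin 3)] at h
  have hpair : LinearIndependent ℝ ![b - a, c - a] := by
    have hcomp := h.comp ![⟨1, by decide⟩, ⟨2, by decide⟩] (by decide)
    rwa [show _ ∘ _ = ![b - a, c - a] by funext i; fin_cases i <;> rfl] at hcomp
  rw [LinearIndependent.pair_iff] at hpair
  intro h0
  unfold triDet at h0
  obtain ⟨-, hb0⟩ := hpair (c 0 - a 0) (-(b 0 - a 0))
    (by apply plane_ext <;> simp <;> linarith)
  obtain ⟨-, hb1⟩ := hpair (c 1 - a 1) (-(b 1 - a 1))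
    (by apply plane_ext <;> simp <;> linarith)
  have hb : b - a = 0 := by apply plane_ext <;> simp <;> linarith
  exact one_ne_zero (hpair 1 0 (by simp [hb])).1

theorem eq_of_dotProduct_sides_eq {a b c : Plane} (h : triDet a b c ≠ 0) {x y : Fin 2 → ℝ}
    (hb : x ⬝ᵥ (b - a).ofLp = y ⬝ᵥ (b - a).ofLp) (hc : x ⬝ᵥ (c - a).ofLp = y ⬝ᵥ (c - a).ofLp) :
    x = y := by
  simp only [dotProduct, Fin.sum_univ_two, PiLp.sub_apply] at hb hc
  unfold triDet at h
  funext i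
  fin_cases i <;> apply mul_left_cancel₀ h
  · simp only [Fin.zero_eta]; linear_combination (c 1 - a 1) * hb - (b 1 - a 1) * hc
  · simp only [Fin.mk_one]; linear_combination (b 0 - a 0) * hc - (c 0 - a 0) * hb

/-- The point with affine coordinates `s`, `t` in the frame of the triangle `a b c`. -/
def triPoint (a b c : Plane) (s t : ℝ) : Plane := a + s • (b - a) + t • (c - a)

theorem triPoint_apply (a b c : Plane) (s t : ℝ) (i : Fin 2) :
    triPoint a b c s t i = a i + s * (b i - a i) + t * (c i - a i) := by
  simp [triPoint]

theorem continuous_triPoint (a b c : Plane) :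
    Continuous fun y : ℝ × ℝ => triPoint a b c y.1 y.2 := by
  unfold triPoint; fun_prop

theorem triPoint_coords {a b c : Plane} (h : triDet a b c ≠ 0) (x : Plane) :
    x = triPoint a b c (triDet a x c / triDet a b c) (triDet a b x / triDet a b c) := by
  apply plane_ext <;> rw [triPoint_apply] <;> field_simp <;> unfold triDet <;> ring

theorem triDet_triPoint_left (a b c : Plane) (s t : ℝ) :
    triDet a (triPoint a b c s t) c = s * triDet a b c := by
  simp only [triDet, triPoint_apply]; ring

theorem triDet_triPoint_right (a b c : Plane) (s t : ℝ) :
    triDet a b (triPoint a b c s t) = t * triDet a b c := by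
  simp only [triDet, triPoint_apply]; ring

theorem mem_convexHull_triple {a b c x : Plane} :
    x ∈ convexHull ℝ ({a, b, c} : Set Plane) ↔
      ∃ s t : ℝ, 0 ≤ s ∧ 0 ≤ t ∧ s + t ≤ 1 ∧ triPoint a b c s t = x := by
  constructor
  · refine fun hx => convexHull_min (t := {x | ∃ s t : ℝ, 0 ≤ s ∧ 0 ≤ t ∧ s + t ≤ 1 ∧
      triPoint a b c s t = x}) ?_ ?_ hx
    · rintro x (rfl | rfl | rfl)
      · exact ⟨0, 0, by simp [triPoint]⟩
      · exact ⟨1, 0, by simp [triPoint]⟩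
      · exact ⟨0, 1, by simp [triPoint]⟩
    · rintro _ ⟨s, t, hs, ht, hst, rfl⟩ _ ⟨s', t', hs', ht', hst', rfl⟩ p q hp hq hpq
      refine ⟨p * s + q * s', p * t + q * t', by positivity, by positivity, by nlinarith, ?_⟩
      obtain rfl := eq_sub_of_add_eq hpq
      simp only [triPoint]
      module
  · rintro ⟨s, t, hs, ht, hst, rfl⟩
    have hmem : ∀ y ∈ ({a, b, c} : Set Plane), y ∈ convexHull ℝ {a, b, c} :=
      fun y hy => subset_convexHull ℝ _ hy
    have := (convex_convexHull ℝ ({a, b, c} : Set Plane)).sum_mem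
      (t := Finset.univ) (w := ![1 - s - t, s, t]) (z := ![a, b, c])
      (fun i _ => by fin_cases i <;> simp <;> linarith) (by simp [Fin.sum_univ_three]; ring)
      (fun i _ => hmem _ (by fin_cases i <;> simp))
    convert this using 1
    simp only [Fin.sum_univ_three, triPoint]
    simp
    module

theorem isCompact_convexHull_triple (a b c : Plane) :
    IsCompact (convexHull ℝ ({a, b, c} : Set Plane)) :=
  (Set.toFinite _).isCompact_convexHull (𝕜 := ℝ)

theorem triPoint_mem_interior {a b c : Plane} (h : triDet a b c ≠ 0) {s t : ℝ} (hs : 0 < s)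
    (ht : 0 < t) (hst : s + t < 1) :
    triPoint a b c s t ∈ interior (convexHull ℝ ({a, b, c} : Set Plane)) := by
  have hleft : Continuous fun x => triDet a x c / triDet a b c := by unfold triDet; fun_prop
  have hright : Continuous fun x => triDet a b x / triDet a b c := by unfold triDet; fun_prop
  have hopen : IsOpen {x | 0 < triDet a x c / triDet a b c ∧ 0 < triDet a b x / triDet a b c ∧
      triDet a x c / triDet a b c + triDet a b x / triDet a b c < 1} :=
    (isOpen_lt continuous_const hleft).inter ((isOpen_lt continuous_const hright).inter
      (isOpen_lt (hleft.add hright) continuous_const))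
  refine mem_interior.2 ⟨_, ?_, hopen, ?_⟩
  · rintro x ⟨h1, h2, h3⟩
    exact mem_convexHull_triple.2 ⟨_, _, h1.le, h2.le, h3.le, (triPoint_coords h x).symm⟩
  · simp only [Set.mem_ofPred_eq, triDet_triPoint_left, triDet_triPoint_right,
      mul_div_cancel_right₀ _ h]
    exact ⟨hs, ht, hst⟩

theorem interior_triangle_nonempty {a b c : Plane} (h : triDet a b c ≠ 0) :
    (interior (convexHull ℝ ({a, b, c} : Set Plane))).Nonempty :=
  ⟨_, triPoint_mem_interior h (s := 1 / 3) (t := 1 / 3) (by norm_num) (by norm_num) (by norm_num)⟩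

theorem eventually_triPoint_mem_interior {a b c c' : Plane}
    (h : 0 < triDet a b c * triDet a b c') :
    ∀ᶠ δ in nhdsWithin (0 : ℝ) (Set.Ioi 0),
      triPoint a b c (1 / 2) δ ∈ interior (convexHull ℝ ({a, b, c'} : Set Plane)) := by
  have hc' : triDet a b c' ≠ 0 := right_ne_zero_of_mul h.ne'
  obtain ⟨p, q, rfl⟩ : ∃ p q, c = triPoint a b c' p q := ⟨_, _, triPoint_coords hc' c⟩
  have hq : 0 < q := by
    rw [triDet_triPoint_right, mul_assoc] at h
    exact pos_of_mul_pos_left h (mul_self_nonneg _)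
  have hpos : ∀ᶠ δ in nhdsWithin (0 : ℝ) (Set.Ioi 0), 0 < 1 / 2 + δ * p :=
    ((by fun_prop : Continuous fun δ : ℝ => 1 / 2 + δ * p).tendsto' 0 (1 / 2) (by simp)
      |>.eventually_const_lt (by norm_num)).filter_mono nhdsWithin_le_nhds
  have hlt : ∀ᶠ δ in nhdsWithin (0 : ℝ) (Set.Ioi 0), 1 / 2 + δ * p + δ * q < 1 :=
    ((by fun_prop : Continuous fun δ : ℝ => 1 / 2 + δ * p + δ * q).tendsto' 0 (1 / 2) (by simp)
      |>.eventually_lt_const (by norm_num)).filter_mono nhdsWithin_le_nhds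
  filter_upwards [hpos, hlt, self_mem_nhdsWithin] with δ h1 h2 (hδ : 0 < δ)
  have hpt : triPoint a b (triPoint a b c' p q) (1 / 2) δ =
      triPoint a b c' (1 / 2 + δ * p) (δ * q) := by
    simp only [triPoint]; module
  rw [hpt]
  exact triPoint_mem_interior hc' h1 (mul_pos hδ hq) h2

theorem not_disjoint_interior_of_same_side {a b c c' : Plane}
    (h : 0 < triDet a b c * triDet a b c') :
    ¬ Disjoint (interior (convexHull ℝ ({a, b, c} : Set Plane)))
      (interior (convexHull ℝ ({a, b, c'} : Set Plane))) := by
  obtain ⟨δ, hc, hc'⟩ := ((eventually_triPoint_mem_interior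
    (mul_self_pos.2 (left_ne_zero_of_mul h.ne'))).and (eventually_triPoint_mem_interior h)).exists
  exact Set.not_disjoint_iff.2 ⟨_, hc, hc'⟩

/-! ### Unit normals -/

theorem ofLp_sub_ne_zero {a b : Plane} (h : a ≠ b) : (b - a).ofLp ≠ 0 :=
  fun h0 => h (sub_eq_zero.1 ((WithLp.ofLp_eq_zero 2).1 h0)).symm

theorem tangent_smul (r : ℝ) (x : Fin 2 → ℝ) : tangent (r • x) = r • tangent x := by
  funext i; fin_cases i <;> simp [tangent]

theorem tangent_dotProduct_self (x : Fin 2 → ℝ) : tangent x ⬝ᵥ x = 0 := by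
  simp [tangent, dotProduct, Fin.sum_univ_two]; ring

theorem tangent_dotProduct_tangent (x : Fin 2 → ℝ) : tangent x ⬝ᵥ tangent x = x ⬝ᵥ x := by
  simp [tangent, dotProduct, Fin.sum_univ_two]; ring

theorem dotProduct_sub_self (a b : Plane) :
    (b - a).ofLp ⬝ᵥ (b - a).ofLp = dist a b ^ 2 := by
  rw [dist_comm, dist_eq_norm, EuclideanSpace.real_norm_sq_eq, dotProduct]
  simp only [sq]

theorem eq_normal_add_tangential {n : Fin 2 → ℝ} (hn : n ⬝ᵥ n = 1) (x : Fin 2 → ℝ) :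
    x = (x ⬝ᵥ n) • n + (x ⬝ᵥ tangent n) • tangent n := by
  simp only [dotProduct, Fin.sum_univ_two] at hn
  funext i
  fin_cases i <;> simp [tangent, dotProduct, Fin.sum_univ_two]
  · linear_combination -(x 0) * hn
  · linear_combination -(x 1) * hn

theorem dotProduct_eq_normal_add_tangential {n : Fin 2 → ℝ} (hn : n ⬝ᵥ n = 1)
    (x y : Fin 2 → ℝ) :
    x ⬝ᵥ y = (x ⬝ᵥ n) * (n ⬝ᵥ y) + (x ⬝ᵥ tangent n) * (tangent n ⬝ᵥ y) := by
  conv_lhs => rw [eq_normal_add_tangential hn x]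
  simp [add_dotProduct, smul_dotProduct]

namespace IsUnitNormal

variable {m n : Fin 2 → ℝ} {a b : Plane}

theorem sub_eq_smul_tangent (hn : IsUnitNormal n a b) :
    (b - a).ofLp = ((b - a).ofLp ⬝ᵥ tangent n) • tangent n := by
  conv_lhs => rw [eq_normal_add_tangential hn.1 (b - a).ofLp]
  rw [dotProduct_comm, hn.2, zero_smul, zero_add]

theorem sub_dotProduct_tangent_ne_zero (hab : a ≠ b) (hn : IsUnitNormal n a b) :
    (b - a).ofLp ⬝ᵥ tangent n ≠ 0 := fun h =>
  ofLp_sub_ne_zero hab (by rw [hn.sub_eq_smul_tangent, h, zero_smul])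

theorem eq_smul (hab : a ≠ b) (hm : IsUnitNormal m a b) (hn : IsUnitNormal n a b) :
    m = (m ⬝ᵥ n) • n := by
  have htangent : m ⬝ᵥ tangent n = 0 := by
    have h := hm.2
    rw [hn.sub_eq_smul_tangent, dotProduct_smul, smul_eq_mul] at h
    exact (mul_eq_zero.1 h).resolve_left (hn.sub_dotProduct_tangent_ne_zero hab)
  conv_lhs => rw [eq_normal_add_tangential hn.1 m]
  rw [htangent, zero_smul, add_zero]

theorem dotProduct_mul_self (hab : a ≠ b) (hm : IsUnitNormal m a b) (hn : IsUnitNormal n a b) :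
    (m ⬝ᵥ n) * (m ⬝ᵥ n) = 1 := by
  have h := hm.1
  rw [hm.eq_smul hab hn] at h
  simpa [smul_dotProduct, dotProduct_smul, hn.1] using h

theorem dotProduct_sub_ne_zero {c : Plane} (h : triDet a b c ≠ 0) (hn : IsUnitNormal n a b) :
    n ⬝ᵥ (c - a).ofLp ≠ 0 := by
  intro h0
  have hzero : n = 0 := eq_of_dotProduct_sides_eq h (by rw [hn.2, zero_dotProduct])
    (by rw [h0, zero_dotProduct])
  simpa [hzero] using hn.1

theorem eq_zero_of_dotProduct_eq_zero {c : Plane} {w : Fin 2 → ℝ} (h : triDet a b c ≠ 0)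
    (hm : IsUnitNormal m a b) (hn : IsUnitNormal n a c) (hwm : w ⬝ᵥ m = 0) (hwn : w ⬝ᵥ n = 0) :
    w = 0 := by
  have tangent_orthogonal : ∀ {d n}, IsUnitNormal n a d → w ⬝ᵥ n = 0 →
      tangent w ⬝ᵥ (d - a).ofLp = 0 := by
    intro d n hn hw
    rw [hn.sub_eq_smul_tangent, dotProduct_smul]
    conv_lhs => rw [eq_normal_add_tangential hn.1 w, hw, zero_smul, zero_add, tangent_smul,
      smul_dotProduct, tangent_dotProduct_self]
    simp
  have hw : tangent w = 0 := eq_of_dotProduct_sides_eq h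
    (by rw [tangent_orthogonal hm hwm, zero_dotProduct])
    (by rw [tangent_orthogonal hn hwn, zero_dotProduct])
  exact dotProduct_self_eq_zero.1 (by rw [← tangent_dotProduct_tangent, hw, zero_dotProduct])

end IsUnitNormal

theorem sign_mul_self {r : ℝ} (h : r ≠ 0) : r.sign * r.sign = 1 := by
  rcases Real.sign_apply_eq_of_ne_zero r h with h | h <;> rw [h] <;> norm_num

theorem outwardNormal_eq {a b c : Plane} (h : triDet a b c ≠ 0) :
    outwardNormal a b c = -((triDet a b c).sign * (dist a b)⁻¹) • tangent (b - a).ofLp := by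
  have hd : 0 < (dist a b)⁻¹ := inv_pos.2 (dist_pos.2 (ne_of_triDet_ne_zero h))
  have hm : ((dist a b)⁻¹ • ![(b - a) 1, -((b - a) 0)] : Fin 2 → ℝ) =
      -(dist a b)⁻¹ • tangent (b - a).ofLp := by
    funext i; fin_cases i <;> simp [tangent, ← mul_neg]
  have hside : (-(dist a b)⁻¹ • tangent (b - a).ofLp) ⬝ᵥ (c - a).ofLp < 0 ↔
      0 < triDet a b c := by
    rw [smul_dotProduct, ← triDet_eq_tangent_dotProduct, smul_eq_mul, neg_mul, neg_lt_zero,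
      mul_pos_iff_of_pos_left hd]
  simp only [outwardNormal, hm, hside]
  split_ifs with hpos
  · rw [Real.sign_of_pos hpos, one_mul]
  · rw [Real.sign_of_neg (lt_of_le_of_ne (not_lt.1 hpos) h)]
    module

theorem outwardNormal_dotProduct_neg {a b c : Plane} (h : triDet a b c ≠ 0) :
    outwardNormal a b c ⬝ᵥ (c - a).ofLp < 0 := by
  have hd : 0 < (dist a b)⁻¹ := inv_pos.2 (dist_pos.2 (ne_of_triDet_ne_zero h))
  rw [outwardNormal_eq h, smul_dotProduct, ← triDet_eq_tangent_dotProduct, smul_eq_mul]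
  have := mul_pos (Real.sign_mul_pos_of_ne_zero _ h) hd
  linarith

theorem triDet_mul_pos_of_outwardNormal_eq {a b c c' : Plane} (hc : triDet a b c ≠ 0)
    (hc' : triDet a b c' ≠ 0) (h : outwardNormal a b c = outwardNormal a b c') :
    0 < triDet a b c * triDet a b c' := by
  have hside := outwardNormal_dotProduct_neg hc
  have hside' := outwardNormal_dotProduct_neg hc'
  rw [← h] at hside'
  rw [outwardNormal_eq hc, smul_dotProduct, ← triDet_eq_tangent_dotProduct, smul_eq_mul]
    at hside hside'
  refine pos_of_mul_pos_right ?_ (sq_nonneg ((triDet a b c).sign * (dist a b)⁻¹))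
  linarith [mul_pos_of_neg_of_neg hside hside']

theorem isUnitNormal_outwardNormal {a b c : Plane} (h : triDet a b c ≠ 0) :
    IsUnitNormal (outwardNormal a b c) a b := by
  have hd : dist a b ≠ 0 := dist_ne_zero.2 (ne_of_triDet_ne_zero h)
  constructor
  · simp only [outwardNormal_eq h, smul_dotProduct, dotProduct_smul, tangent_dotProduct_tangent,
      dotProduct_sub_self, smul_eq_mul]
    field_simp
    linear_combination sign_mul_self h
  · rw [outwardNormal_eq h, smul_dotProduct, tangent_dotProduct_self, smul_zero]

theorem outwardNormal_symm {a b c : Plane} (h : triDet a b c ≠ 0) :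
    outwardNormal b a c = outwardNormal a b c := by
  have h' : triDet b a c = -triDet a b c := by rw [← triDet_rotate, triDet_swap]
  rw [outwardNormal_eq h, outwardNormal_eq (h' ▸ neg_ne_zero.2 h), h', Real.sign_neg, dist_comm,
    ← neg_sub b a, WithLp.ofLp_neg, ← neg_one_smul ℝ (b - a).ofLp, tangent_smul]
  module

/-! ### The divergence theorem on a triangle -/

@[fun_prop]
theorem continuous_val (p : Poly) : Continuous fun x => val p x :=
  (MvPolynomial.continuous_eval p).comp (PiLp.continuous_ofLp 2 _)

theorem hasDerivAt_val_line (p : Poly) (x d : Plane) (s : ℝ) :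
    HasDerivAt (fun s : ℝ => val p (x + s • d)) (vval (grad p) (x + s • d) ⬝ᵥ d.ofLp) s := by
  simp only [vval, val, grad, dotProduct, Fin.sum_univ_two]
  induction p using MvPolynomial.induction_on with
  | C a => simpa using hasDerivAt_const s a
  | add p q hp hq =>
    convert! hp.add hq using 1
    · funext s; simp
    · simp only [map_add]; ring
  | mul_X p i hp =>
    have hX : HasDerivAt (fun s : ℝ => (x + s • d) i) (d i) s := by
      simpa using ((hasDerivAt_id s).mul_const (d i)).const_add (x i)
    convert! hp.mul hX using 1
    · funext s; simp
    · fin_cases i <;> simp [Derivation.leibniz, MvPolynomial.pderiv_X] <;> ring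

/-- The triangle with vertices `(0, 0)`, `(1, 0)`, `(0, 1)`, the range of the affine coordinates
of the points of a triangle. -/
def refTriangle : Set (ℝ × ℝ) := {y | 0 ≤ y.1 ∧ 0 ≤ y.2 ∧ y.1 + y.2 ≤ 1}

theorem isClosed_refTriangle : IsClosed refTriangle :=
  (isClosed_le continuous_const continuous_fst).inter
    ((isClosed_le continuous_const continuous_snd).inter
      (isClosed_le (continuous_fst.add continuous_snd) continuous_const))

theorem isCompact_refTriangle : IsCompact refTriangle :=
  (isCompact_Icc (a := ((0 : ℝ), (0 : ℝ))) (b := (1, 1))).of_isClosed_subset isClosed_refTriangle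
    fun y ⟨h1, h2, h3⟩ => ⟨⟨h1, h2⟩, ⟨by simp only; linarith, by simp only; linarith⟩⟩

theorem triangle_eq_image (a b c : Plane) :
    convexHull ℝ ({a, b, c} : Set Plane) =
      (fun y : ℝ × ℝ => triPoint a b c y.1 y.2) '' refTriangle := by
  ext x
  simp [mem_convexHull_triple, refTriangle, and_assoc]

theorem integral_refTriangle {h : ℝ × ℝ → ℝ} (hh : Continuous h) :
    ∫ y in refTriangle, h y = ∫ t in (0 : ℝ)..1, ∫ s in (0 : ℝ)..(1 - t), h (s, t) := by
  have hmeas := isClosed_refTriangle.measurableSet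
  rw [← integral_indicator hmeas, Measure.volume_eq_prod,
    integral_prod_symm _ ((integrable_indicator_iff hmeas).2
      (hh.continuousOn.integrableOn_compact isCompact_refTriangle)),
    intervalIntegral.integral_of_le zero_le_one, ← integral_Icc_eq_integral_Ioc,
    ← integral_indicator measurableSet_Icc]
  congr 1 with t
  by_cases ht : t ∈ Set.Icc (0 : ℝ) 1
  · rw [Set.indicator_of_mem ht, intervalIntegral.integral_of_le (by linarith [ht.2]),
      ← integral_Icc_eq_integral_Ioc, ← integral_indicator measurableSet_Icc]
    congr 1 with s
    have hmem : (s, t) ∈ refTriangle ↔ s ∈ Set.Icc 0 (1 - t) := by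
      simp [refTriangle, ht.1, le_sub_iff_add_le]
    by_cases hs : s ∈ Set.Icc 0 (1 - t)
    · rw [Set.indicator_of_mem hs, Set.indicator_of_mem (hmem.2 hs)]
    · rw [Set.indicator_of_notMem hs, Set.indicator_of_notMem (mt hmem.1 hs)]
  · rw [Set.indicator_of_notMem ht, ← integral_zero ℝ ℝ (μ := volume)]
    congr 1 with s
    refine Set.indicator_of_notMem (fun hst => ht ⟨hst.2.1, ?_⟩) _
    linarith [hst.1, hst.2.2]

/-- The linear part of the affine map from the coordinates `(s, t)` to `triPoint a b c s t`. -/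
def triFrame (a b c : Plane) : Plane →L[ℝ] Plane :=
  (Matrix.toEuclideanLin !![b 0 - a 0, c 0 - a 0; b 1 - a 1, c 1 - a 1]).toContinuousLinearMap

theorem add_triFrame (a b c x : Plane) : a + triFrame a b c x = triPoint a b c (x 0) (x 1) := by
  apply plane_ext <;>
    simp [triFrame, triPoint_apply, Matrix.toLpLin_apply, dotProduct, Fin.sum_univ_two] <;> ring

theorem det_triFrame (a b c : Plane) : (triFrame a b c).det = triDet a b c := by
  rw [triFrame, LinearMap.det_toContinuousLinearMap,
    Matrix.toEuclideanLin_eq_toLin_orthonormal, LinearMap.det_toLin, Matrix.det_fin_two_of, triDet]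
  ring

/-- The measure preserving identification of pairs of coordinates with points of the plane. -/
def pairEquiv : ℝ × ℝ ≃ᵐ Plane :=
  MeasurableEquiv.finTwoArrow.symm.trans (MeasurableEquiv.toLp 2 (Fin 2 → ℝ))

theorem measurePreserving_pairEquiv : MeasurePreserving pairEquiv :=
  ((volume_preserving_finTwoArrow ℝ).symm _).trans (PiLp.volume_preserving_toLp (Fin 2))

theorem integral_image_triPoint {a b c : Plane} (hd : triDet a b c ≠ 0) {Q : Set (ℝ × ℝ)}
    (hQ : MeasurableSet Q) (h : Plane → ℝ) :
    ∫ x in (fun y : ℝ × ℝ => triPoint a b c y.1 y.2) '' Q, h x =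
      |triDet a b c| * ∫ y in Q, h (triPoint a b c y.1 y.2) := by
  have hpair (y : ℝ × ℝ) : a + triFrame a b c (pairEquiv y) = triPoint a b c y.1 y.2 :=
    add_triFrame a b c _
  have hinj : Function.Injective (triFrame a b c) :=
    ((triFrame a b c).toContinuousLinearEquivOfDetNeZero (by rwa [det_triFrame])).injective
  have himage : (fun y : ℝ × ℝ => triPoint a b c y.1 y.2) '' Q =
      (fun x => a + triFrame a b c x) '' (pairEquiv '' Q) := by
    simp only [Set.image_image, hpair]
  rw [himage, integral_image_eq_integral_abs_det_fderiv_smul volume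
    (pairEquiv.measurableSet_image.2 hQ)
    (fun x _ => ((triFrame a b c).hasFDerivAt.const_add a).hasFDerivWithinAt)
    (fun x _ y _ hxy => hinj (add_left_cancel hxy)),
    measurePreserving_pairEquiv.setIntegral_image_emb pairEquiv.measurableEmbedding]
  simp only [hpair, det_triFrame, smul_eq_mul, integral_const_mul]

theorem integral_triangle {a b c : Plane} (hd : triDet a b c ≠ 0) {h : Plane → ℝ}
    (hh : Continuous h) :
    ∫ x in convexHull ℝ ({a, b, c} : Set Plane), h x =
      |triDet a b c| * ∫ t in (0 : ℝ)..1, ∫ s in (0 : ℝ)..(1 - t), h (triPoint a b c s t) := by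
  rw [triangle_eq_image, integral_image_triPoint hd isClosed_refTriangle.measurableSet,
    integral_refTriangle (h := fun y => h (triPoint a b c y.1 y.2))
      (hh.comp (continuous_triPoint a b c))]

/-- The integral of `∇p` over the triangle `a b c`. -/
def gradIntegral (p : Poly) (a b c : Plane) : Fin 2 → ℝ :=
  fun j => ∫ x in convexHull ℝ ({a, b, c} : Set Plane), val (MvPolynomial.pderiv j p) x

theorem continuous_vval_grad_dotProduct (p : Poly) (d : Fin 2 → ℝ) :
    Continuous fun x => vval (grad p) x ⬝ᵥ d :=
  continuous_finsetSum _ fun _ _ => (continuous_val _).mul continuous_const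

theorem gradIntegral_dotProduct (p : Poly) (a b c : Plane) (d : Fin 2 → ℝ) :
    gradIntegral p a b c ⬝ᵥ d =
      ∫ x in convexHull ℝ ({a, b, c} : Set Plane), vval (grad p) x ⬝ᵥ d := by
  simp only [gradIntegral, dotProduct, vval, grad]
  rw [integral_finsetSum]
  · simp only [integral_mul_const]
  · exact fun j _ => ((continuous_val _).continuousOn.integrableOn_compact
      (isCompact_convexHull_triple a b c)).mul_const _

theorem gradIntegral_dotProduct_side {a b c : Plane} (hd : triDet a b c ≠ 0) (p : Poly) :
    gradIntegral p a b c ⬝ᵥ (b - a).ofLp =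
      |triDet a b c| * ((∫ t in (0 : ℝ)..1, val p (AffineMap.lineMap b c t)) -
        ∫ t in (0 : ℝ)..1, val p (AffineMap.lineMap a c t)) := by
  have hline (x y : Plane) :
      IntervalIntegrable (fun t : ℝ => val p (AffineMap.lineMap x y t)) volume 0 1 :=
    ((continuous_val p).comp AffineMap.lineMap_continuous).intervalIntegrable _ _
  rw [gradIntegral_dotProduct, integral_triangle hd (continuous_vval_grad_dotProduct p _),
    ← intervalIntegral.integral_sub (hline b c) (hline a c)]
  congr 2 with t
  have hpoint (s : ℝ) : triPoint a b c s t = (a + t • (c - a)) + s • (b - a) := by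
    unfold triPoint; abel
  simp only [hpoint]
  rw [intervalIntegral.integral_eq_sub_of_hasDerivAt
    (fun s _ => hasDerivAt_val_line p (a + t • (c - a)) (b - a) s)
    (((continuous_vval_grad_dotProduct p _).comp (by fun_prop)).intervalIntegrable _ _)]
  congr 2 <;> simp only [AffineMap.lineMap_apply, vsub_eq_sub, vadd_eq_add] <;> module

theorem segIntegral_smul_outwardNormal {a b c : Plane} (hd : triDet a b c ≠ 0) (φ : Plane → ℝ) :
    segIntegral φ a b • outwardNormal a b c =
      -((triDet a b c).sign * ∫ t in (0 : ℝ)..1, φ (AffineMap.lineMap a b t)) •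
        tangent (b - a).ofLp := by
  have hab : dist a b ≠ 0 := dist_ne_zero.2 (ne_of_triDet_ne_zero hd)
  rw [outwardNormal_eq hd, segIntegral, smul_smul]
  congr 1
  field_simp

theorem integral_lineMap_symm {a b : Plane} (h : a ≠ b) (φ : Plane → ℝ) :
    ∫ t in (0 : ℝ)..1, φ (AffineMap.lineMap a b t) =
      ∫ t in (0 : ℝ)..1, φ (AffineMap.lineMap b a t) := by
  have hsymm := segIntegral_symm φ a b
  rw [segIntegral, segIntegral, dist_comm b a] at hsymm
  exact mul_left_cancel₀ (dist_ne_zero.2 h) hsymm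

/-- Both sides have the same products with the sides `b - a` and `c - a`. -/
theorem gradIntegral_eq {a b c : Plane} (hd : triDet a b c ≠ 0) (p : Poly) :
    gradIntegral p a b c =
      segIntegral (val p) b c • outwardNormal b c a +
      segIntegral (val p) a b • outwardNormal a b c +
      segIntegral (val p) a c • outwardNormal a c b := by
  have hd' : triDet a c b ≠ 0 := by rwa [triDet_swap, neg_ne_zero]
  have hd'' : triDet b c a ≠ 0 := by rwa [triDet_rotate]
  have hb := gradIntegral_dotProduct_side hd p
  have hc := gradIntegral_dotProduct_side hd' p
  have hswap : gradIntegral p a c b = gradIntegral p a b c := by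
    unfold gradIntegral; rw [Set.pair_comm c b]
  rw [hswap, triDet_swap a b c, abs_neg,
    integral_lineMap_symm (ne_of_triDet_ne_zero hd'').symm] at hc
  have habs : |triDet a b c| = (triDet a b c).sign * triDet a b c := by
    rcases hd.lt_or_gt with h | h
    · rw [abs_of_neg h, Real.sign_of_neg h, neg_one_mul]
    · rw [abs_of_pos h, Real.sign_of_pos h, one_mul]
  rw [habs] at hb hc
  rw [segIntegral_smul_outwardNormal hd, segIntegral_smul_outwardNormal hd',
    segIntegral_smul_outwardNormal hd'', triDet_swap a b c, triDet_rotate a b c, Real.sign_neg]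
  generalize (triDet a b c).sign = σ at hb hc ⊢
  apply eq_of_dotProduct_sides_eq hd <;> rw [‹gradIntegral p a b c ⬝ᵥ _ = _›] <;>
    simp only [triDet, tangent, dotProduct, Fin.sum_univ_two, Pi.add_apply, Pi.smul_apply,
      smul_eq_mul, PiLp.sub_apply, cons_val_zero, cons_val_one, cons_val_fin_one] <;> ring

/-! ### Values of piecewise polynomials -/

theorem val_add (p q : Poly) (x : Plane) : val (p + q) x = val p x + val q x := by simp [val]

theorem val_mul (p q : Poly) (x : Plane) : val (p * q) x = val p x * val q x := by simp [val]

theorem val_smul (r : ℝ) (p : Poly) (x : Plane) : val (r • p) x = r * val p x := by simp [val]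

theorem val_sum {ι : Type*} (s : Finset ι) (p : ι → Poly) (x : Plane) :
    val (∑ i ∈ s, p i) x = ∑ i ∈ s, val (p i) x := by simp [val]

theorem val_dotProduct (u v : Fin 2 → Poly) (x : Plane) :
    val (u ⬝ᵥ v) x = vval u x ⬝ᵥ vval v x := by
  simp only [dotProduct, val_sum, val_mul, vval]

theorem vval_add (u v : Fin 2 → Poly) (x : Plane) : vval (u + v) x = vval u x + vval v x :=
  funext fun _ => val_add _ _ _

theorem vval_smul (r : ℝ) (v : Fin 2 → Poly) (x : Plane) : vval (r • v) x = r • vval v x :=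
  funext fun _ => val_smul _ _ _

theorem vval_poly_smul (q : Poly) (v : Fin 2 → Poly) (x : Plane) :
    vval (q • v) x = val q x • vval v x :=
  funext fun _ => val_mul _ _ _

theorem vval_vecMul (v : Fin 2 → Poly) (G : Matrix (Fin 2) (Fin 2) Poly) (x : Plane) :
    vval (v ᵥ* G) x = vval v x ᵥ* mval G x := by
  funext j
  simp only [vval, vecMul, mval, dotProduct, val_sum, val_mul, of_apply]

theorem mval_add (G H : Matrix (Fin 2) (Fin 2) Poly) (x : Plane) :
    mval (G + H) x = mval G x + mval H x :=
  Matrix.ext fun _ _ => val_add _ _ _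

theorem mval_smul (r : ℝ) (G : Matrix (Fin 2) (Fin 2) Poly) (x : Plane) :
    mval (r • G) x = r • mval G x :=
  Matrix.ext fun _ _ => val_smul _ _ _

@[fun_prop]
theorem continuous_vval (v : Fin 2 → Poly) : Continuous fun x => vval v x :=
  continuous_pi fun i => continuous_val (v i)

@[fun_prop]
theorem continuous_mval (G : Matrix (Fin 2) (Fin 2) Poly) : Continuous fun x => mval G x :=
  continuous_matrix fun i j => continuous_val (G i j)

@[fun_prop]
theorem continuous_ddot {A B : Plane → Matrix (Fin 2) (Fin 2) ℝ} (hA : Continuous A)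
    (hB : Continuous B) : Continuous fun x => ddot (A x) (B x) := by
  unfold ddot
  fun_prop

theorem dvg_smul (q : Poly) (v : Fin 2 → Poly) : dvg (q • v) = v ⬝ᵥ grad q + q * dvg v := by
  simp only [dvg, grad, dotProduct, Pi.smul_apply, Derivation.leibniz, smul_eq_mul,
    Fin.sum_univ_two]
  ring

theorem val_dvg_vecMul (v : Fin 2 → Poly) (G : Matrix (Fin 2) (Fin 2) Poly) (x : Plane) :
    val (dvg (v ᵥ* G)) x =
      vval v x ⬝ᵥ vval (mdvg G) x + ddot (mval G x) (mval (vgrad v) x) := by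
  simp only [dvg, mdvg, vgrad, ddot, vval, mval, vecMul, dotProduct, Derivation.leibniz,
    smul_eq_mul, Fin.sum_univ_two, map_add, of_apply, val_add, val_mul]
  ring

/-! ### Integrals over the edges and triangles of a mesh -/

theorem edgeSet_mk (a b : Plane) : edgeSet s(a, b) = segment ℝ a b := by
  rw [← convexHull_pair, edgeSet]
  congr 1
  ext x
  simp

theorem edgeIntegral_mk (φ : Plane → ℝ) (a b : Plane) :
    edgeIntegral s(a, b) φ = segIntegral φ a b := rfl

theorem edgeIntegral_congr {e : Sym2 Plane} {φ ψ : Plane → ℝ} (h : ∀ x ∈ edgeSet e, φ x = ψ x) :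
    edgeIntegral e φ = edgeIntegral e ψ := by
  induction e using Sym2.ind with
  | _ a b =>
    rw [edgeIntegral_mk, edgeIntegral_mk, segIntegral, segIntegral]
    congr 1
    refine intervalIntegral.integral_congr fun s hs => h _ ?_
    rw [Set.uIcc_of_le zero_le_one] at hs
    rw [edgeSet_mk, segment_eq_image_lineMap]
    exact ⟨s, hs, rfl⟩

theorem edgeIntegral_sum {ι : Type*} (e : Sym2 Plane) (s : Finset ι) {φ : ι → Plane → ℝ}
    (hφ : ∀ i, Continuous (φ i)) :
    edgeIntegral e (fun x => ∑ i ∈ s, φ i x) = ∑ i ∈ s, edgeIntegral e (φ i) := by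
  induction e using Sym2.ind with
  | _ a b =>
    simp only [edgeIntegral_mk, segIntegral]
    rw [intervalIntegral.integral_finsetSum, Finset.mul_sum]
    exact fun i _ => ((hφ i).comp AffineMap.lineMap_continuous).intervalIntegrable _ _

theorem edgeIntegral_add (e : Sym2 Plane) {φ ψ : Plane → ℝ} (hφ : Continuous φ)
    (hψ : Continuous ψ) :
    edgeIntegral e (fun x => φ x + ψ x) = edgeIntegral e φ + edgeIntegral e ψ := by
  have h := edgeIntegral_sum e Finset.univ (φ := ![φ, ψ]) (Fin.forall_fin_two.2 ⟨hφ, hψ⟩)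
  simp only [Fin.sum_univ_two] at h
  exact h

theorem edgeIntegral_const_mul (e : Sym2 Plane) (r : ℝ) (φ : Plane → ℝ) :
    edgeIntegral e (fun x => r * φ x) = r * edgeIntegral e φ := by
  induction e using Sym2.ind with
  | _ a b =>
    simp only [edgeIntegral_mk, segIntegral, intervalIntegral.integral_const_mul]
    ring

namespace Mesh

variable {Ω : Set Plane} (M : Mesh Ω)

theorem isCompact_triSet (τ : M.Tri) : IsCompact (M.triSet τ) :=
  isCompact_convexHull_triple _ _ _

theorem integral_congr {φ ψ : M.Tri → Plane → ℝ} (h : ∀ τ x, φ τ x = ψ τ x) :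
    M.integral φ = M.integral ψ :=
  congrArg _ (funext₂ h)

theorem integral_add {φ ψ : M.Tri → Plane → ℝ} (hφ : ∀ τ, IntegrableOn (φ τ) (M.triSet τ))
    (hψ : ∀ τ, IntegrableOn (ψ τ) (M.triSet τ)) :
    M.integral (fun τ x => φ τ x + ψ τ x) = M.integral φ + M.integral ψ := by
  simp only [integral, MeasureTheory.integral_add (hφ _) (hψ _), Finset.sum_add_distrib]

theorem integral_const_mul (r : ℝ) (φ : M.Tri → Plane → ℝ) :
    M.integral (fun τ x => r * φ τ x) = r * M.integral φ := by
  simp only [integral, MeasureTheory.integral_const_mul, Finset.mul_sum]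

theorem integrableOn_triSet {φ : Plane → ℝ} (hφ : Continuous φ) (τ : M.Tri) :
    IntegrableOn φ (M.triSet τ) :=
  hφ.continuousOn.integrableOn_compact (M.isCompact_triSet τ)

theorem primalIntegral_congr {φ ψ : M.PrimalEdge → Plane → ℝ}
    (h : ∀ (e : M.PrimalEdge), ∀ x ∈ edgeSet e.1, φ e x = ψ e x) :
    M.primalIntegral φ = M.primalIntegral ψ :=
  Finset.sum_congr rfl fun e _ => edgeIntegral_congr (h e)

theorem dualIntegral_congr {φ ψ : M.DualEdge → Plane → ℝ}
    (h : ∀ e, ∀ x ∈ edgeSet (M.dualSym e), φ e x = ψ e x) :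
    M.dualIntegral φ = M.dualIntegral ψ :=
  Finset.sum_congr rfl fun e _ => edgeIntegral_congr (h e)

theorem dualIntegral_add {φ ψ : M.DualEdge → Plane → ℝ} (hφ : ∀ e, Continuous (φ e))
    (hψ : ∀ e, Continuous (ψ e)) :
    M.dualIntegral (fun e x => φ e x + ψ e x) = M.dualIntegral φ + M.dualIntegral ψ := by
  simp only [dualIntegral, edgeIntegral_add _ (hφ _) (hψ _), Finset.sum_add_distrib]

theorem dualIntegral_const_mul (r : ℝ) (φ : M.DualEdge → Plane → ℝ) :
    M.dualIntegral (fun e x => r * φ e x) = r * M.dualIntegral φ := by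
  simp only [dualIntegral, edgeIntegral_const_mul, Finset.mul_sum]

/-! ### Edges and their triangles -/

theorem triDet_center_ne_zero (τ : M.Tri) : triDet (M.center τ.1) (M.fst τ) (M.snd τ) ≠ 0 :=
  triDet_ne_zero (M.nondegenerate τ.1 τ.2)

theorem triDet_primal_ne_zero (τ : M.Tri) : triDet (M.fst τ) (M.snd τ) (M.center τ.1) ≠ 0 := by
  rw [triDet_rotate]
  exact M.triDet_center_ne_zero τ

theorem fst_ne_snd (τ : M.Tri) : M.fst τ ≠ M.snd τ :=
  ne_of_triDet_ne_zero (M.triDet_primal_ne_zero τ)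

theorem center_ne_vertex (e : M.DualEdge) : M.center e.1 ≠ M.vertex e.1 e.2 :=
  ne_of_triDet_ne_zero (M.triDet_center_ne_zero e)

theorem snd_before (e : M.DualEdge) : M.snd (M.before e) = M.vertex e.1 e.2 := by
  change M.vertex e.1 (finRotate _ ((finRotate _).symm e.2)) = _
  rw [Equiv.apply_symm_apply]

theorem triDet_before_ne_zero (e : M.DualEdge) :
    triDet (M.center e.1) (M.vertex e.1 e.2) (M.vertex e.1 ((finRotate _).symm e.2)) ≠ 0 := by
  have h := M.triDet_center_ne_zero (M.before e)
  rw [snd_before] at h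
  rwa [triDet_swap, neg_ne_zero]

theorem before_ne_after (e : M.DualEdge) : M.before e ≠ M.after e := by
  intro h
  have hsymm : (finRotate (M.sides e.1)).symm e.2 = e.2 := by
    simpa [before, after, Sigma.ext_iff] using h
  have hrot : finRotate (M.sides e.1) e.2 = e.2 := ((Equiv.symm_apply_eq _).1 hsymm).symm
  exact M.fst_ne_snd e (by simp only [fst, snd, hrot])

/-- The next triangle, or the next dual edge, in the same cell. -/
def next : M.Tri ≃ M.Tri := Equiv.sigmaCongrRight fun c => finRotate (M.sides c)

theorem before_next (τ : M.Tri) : M.before (M.next τ) = τ := by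
  obtain ⟨c, i⟩ := τ
  change (⟨c, (finRotate _).symm (finRotate _ i)⟩ : M.Tri) = ⟨c, i⟩
  rw [Equiv.symm_apply_apply]

theorem normalBefore_next (τ : M.Tri) :
    M.normalBefore (M.next τ) = outwardNormal (M.center τ.1) (M.snd τ) (M.fst τ) := by
  change outwardNormal (M.center τ.1) (M.snd τ)
    (M.vertex τ.1 ((finRotate _).symm (finRotate _ τ.2))) = _
  rw [Equiv.symm_apply_apply]
  rfl

/-- Triangles with a common side and the same outward normal on it lie on the same side of it,
so they overlap. -/
theorem outwardNormal_ne {τ τ' : M.Tri} (hne : τ ≠ τ') {a b c c' : Plane}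
    (hτ : ({M.center τ.1, M.fst τ, M.snd τ} : Set Plane) = {a, b, c})
    (hτ' : ({M.center τ'.1, M.fst τ', M.snd τ'} : Set Plane) = {a, b, c'})
    (hc : triDet a b c ≠ 0) (hc' : triDet a b c' ≠ 0) :
    outwardNormal a b c ≠ outwardNormal a b c' := by
  intro h
  have hdis : Disjoint (interior (convexHull ℝ {M.center τ.1, M.fst τ, M.snd τ}))
    (interior (convexHull ℝ {M.center τ'.1, M.fst τ', M.snd τ'})) := M.disjoint_interior τ τ' hne
  rw [hτ, hτ'] at hdis
  exact not_disjoint_interior_of_same_side (triDet_mul_pos_of_outwardNormal_eq hc hc' h) hdis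

theorem eq_of_normalPrimal_eq {τ τ' : M.Tri} (he : M.primalEdge τ = M.primalEdge τ')
    (hn : M.normalPrimal τ = M.normalPrimal τ') : τ = τ' := by
  by_contra hne
  have hrot : ∀ x y z : Plane, ({x, y, z} : Set Plane) = {y, z, x} := fun x y z => by
    rw [Set.insert_comm, Set.pair_comm x z]
  have hd' := M.triDet_primal_ne_zero τ'
  rcases Sym2.eq_iff.1 (congrArg Subtype.val he) with ⟨ha, hb⟩ | ⟨ha, hb⟩
  · rw [← ha, ← hb] at hd'
    refine M.outwardNormal_ne hne (hrot _ _ _) ?_ (M.triDet_primal_ne_zero τ) hd' ?_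
    · rw [hrot, ha, hb]
    · rwa [normalPrimal, normalPrimal, ← ha, ← hb] at hn
  · rw [normalPrimal, normalPrimal, ← outwardNormal_symm hd', ← ha, ← hb] at hn
    rw [← triDet_rotate, triDet_swap, neg_ne_zero, ← ha, ← hb] at hd'
    refine M.outwardNormal_ne hne (hrot _ _ _) ?_ (M.triDet_primal_ne_zero τ) hd' hn
    rw [hrot, ha, hb, Set.insert_comm]

theorem normalBefore_ne_normalAfter (e : M.DualEdge) : M.normalBefore e ≠ M.normalAfter e := by
  refine M.outwardNormal_ne (M.before_ne_after e) ?_ rfl (M.triDet_before_ne_zero e)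
    (M.triDet_center_ne_zero e)
  rw [snd_before, Set.pair_comm (M.fst (M.before e))]
  rfl

theorem primalEdge_side (e : M.PrimalEdge) : M.primalEdge (M.side e) = e :=
  Subtype.ext e.2.choose_spec

namespace EdgeNormals

variable {M} (N : M.EdgeNormals)

theorem side_eq_of_not_isInteriorEdge (N : M.EdgeNormals) {τ : M.Tri}
    (he : ¬ M.IsInteriorEdge (M.primalEdge τ)) : M.side (M.primalEdge τ) = τ := by
  have hs := M.primalEdge_side (M.primalEdge τ)
  have hside := N.primal_outward (M.side (M.primalEdge τ)) (by rwa [hs])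
  rw [hs, N.primal_outward τ he] at hside
  exact M.eq_of_normalPrimal_eq hs hside.symm

theorem normalPrimal_eq (τ : M.Tri) : M.normalPrimal τ =
    (M.normalPrimal τ ⬝ᵥ N.primal (M.primalEdge τ)) • N.primal (M.primalEdge τ) :=
  (isUnitNormal_outwardNormal (M.triDet_primal_ne_zero τ)).eq_smul (M.fst_ne_snd τ)
    (N.primal_isUnitNormal τ)

theorem isUnitNormal_normalBefore (e : M.DualEdge) :
    IsUnitNormal (M.normalBefore e) (M.center e.1) (M.vertex e.1 e.2) :=
  isUnitNormal_outwardNormal (M.triDet_before_ne_zero e)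

theorem isUnitNormal_normalAfter (e : M.DualEdge) :
    IsUnitNormal (M.normalAfter e) (M.center e.1) (M.vertex e.1 e.2) :=
  isUnitNormal_outwardNormal (M.triDet_center_ne_zero e)

theorem normalBefore_eq (e : M.DualEdge) :
    M.normalBefore e = (M.normalBefore e ⬝ᵥ N.dual e) • N.dual e :=
  (isUnitNormal_normalBefore e).eq_smul (M.center_ne_vertex e) (N.dual_isUnitNormal e)

theorem normalAfter_eq (e : M.DualEdge) :
    M.normalAfter e = (M.normalAfter e ⬝ᵥ N.dual e) • N.dual e :=
  (isUnitNormal_normalAfter e).eq_smul (M.center_ne_vertex e) (N.dual_isUnitNormal e)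

theorem normalAfter_dotProduct_ne_zero (e : M.DualEdge) : M.normalAfter e ⬝ᵥ N.dual e ≠ 0 :=
  left_ne_zero_of_mul_eq_one
    ((isUnitNormal_normalAfter e).dotProduct_mul_self (M.center_ne_vertex e)
      (N.dual_isUnitNormal e))

theorem normalBefore_dotProduct_eq_neg (e : M.DualEdge) :
    M.normalBefore e ⬝ᵥ N.dual e = -(M.normalAfter e ⬝ᵥ N.dual e) := by
  have hB := (isUnitNormal_normalBefore e).dotProduct_mul_self (M.center_ne_vertex e)
    (N.dual_isUnitNormal e)
  have hA := (isUnitNormal_normalAfter e).dotProduct_mul_self (M.center_ne_vertex e)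
    (N.dual_isUnitNormal e)
  refine (mul_self_eq_mul_self_iff.1 (hB.trans hA.symm)).resolve_left fun h =>
    M.normalBefore_ne_normalAfter e ?_
  rw [N.normalBefore_eq, N.normalAfter_eq, h]

/-! ### Jumps -/

section Jump

variable {V : Type} [AddCommGroup V] [Module ℝ V]

theorem jumpDual_eq_smul_sub (φ : M.Tri → V) (e : M.DualEdge) : N.jumpDual φ e =
    (M.normalAfter e ⬝ᵥ N.dual e) • (φ (M.after e) - φ (M.before e)) := by
  rw [jumpDual, normalBefore_dotProduct_eq_neg]
  module

theorem jumpDual_add (φ ψ : M.Tri → V) (e : M.DualEdge) :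
    N.jumpDual (fun τ => φ τ + ψ τ) e = N.jumpDual φ e + N.jumpDual ψ e := by
  simp only [jumpDual]
  module

theorem jumpDual_smul (r : ℝ) (φ : M.Tri → V) (e : M.DualEdge) :
    N.jumpDual (fun τ => r • φ τ) e = r • N.jumpDual φ e := by
  simp only [jumpDual]
  module

theorem jumpDual_mul_of_eq {φ : M.Tri → ℝ} (ψ : M.Tri → ℝ) {e : M.DualEdge}
    (h : φ (M.before e) = φ (M.after e)) :
    N.jumpDual (fun τ => φ τ * ψ τ) e = φ (M.after e) * N.jumpDual ψ e := by
  simp only [jumpDual, h, smul_eq_mul]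
  ring

theorem dotProduct_jumpDual (w : Fin 2 → ℝ) (φ : M.Tri → Fin 2 → ℝ) (e : M.DualEdge) :
    w ⬝ᵥ N.jumpDual φ e = N.jumpDual (fun τ => w ⬝ᵥ φ τ) e := by
  simp only [jumpDual, dotProduct_add, dotProduct_smul]

@[fun_prop]
theorem continuous_jumpDual [TopologicalSpace V] [ContinuousAdd V] [ContinuousSMul ℝ V]
    {φ : M.Tri → Plane → V} (hφ : ∀ τ, Continuous (φ τ)) (e : M.DualEdge) :
    Continuous fun x => N.jumpDual (fun τ => φ τ x) e := by
  unfold jumpDual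
  fun_prop

theorem mul_jumpPrimal {r : ℝ} {e : M.PrimalEdge} {φ ψ : M.Tri → ℝ}
    (h : ∀ τ, M.primalEdge τ = e → r * φ τ = ψ τ) :
    r * N.jumpPrimal φ e = N.jumpPrimal ψ e := by
  rw [jumpPrimal, Finset.mul_sum]
  refine Finset.sum_congr rfl fun τ hτ => ?_
  rw [mul_smul_comm, h τ (Finset.mem_filter.1 hτ).2]

theorem jumpPrimal_dotProduct {w : Fin 2 → ℝ} {e : M.PrimalEdge} {φ : M.Tri → Fin 2 → ℝ}
    {ψ : M.Tri → ℝ} (h : ∀ τ, M.primalEdge τ = e → φ τ ⬝ᵥ w = ψ τ) :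
    N.jumpPrimal φ e ⬝ᵥ w = N.jumpPrimal ψ e := by
  rw [jumpPrimal, sum_dotProduct]
  refine Finset.sum_congr rfl fun τ hτ => ?_
  rw [smul_dotProduct, h τ (Finset.mem_filter.1 hτ).2]

end Jump

/-! ### The divergence theorem on a mesh -/

theorem integral_triSet_dvg (τ : M.Tri) (F : Fin 2 → Poly) :
    ∫ x in M.triSet τ, val (dvg F) x =
      edgeIntegral (M.primalEdge τ).1 (fun x => vval F x ⬝ᵥ M.normalPrimal τ) +
      edgeIntegral (M.dualSym τ) (fun x => vval F x ⬝ᵥ M.normalAfter τ) +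
      edgeIntegral (M.dualSym (M.next τ)) (fun x => vval F x ⬝ᵥ M.normalBefore (M.next τ)) := by
  have hflux : ∀ e n, edgeIntegral e (fun x => vval F x ⬝ᵥ n) =
      ∑ j, edgeIntegral e (val (F j)) * n j := fun e n => by
    simp only [dotProduct, vval, mul_comm _ (n _)]
    rw [edgeIntegral_sum _ _ fun j => by fun_prop]
    simp only [edgeIntegral_const_mul]
  have hgrad := fun j => congrFun (gradIntegral_eq (M.triDet_center_ne_zero τ) (F j)) j
  simp only [dvg, val_sum]
  rw [MeasureTheory.integral_finsetSum _ fun j _ => M.integrableOn_val _ τ, hflux, hflux, hflux,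
    ← Finset.sum_add_distrib, ← Finset.sum_add_distrib, normalBefore_next]
  exact Finset.sum_congr rfl fun j _ => hgrad j

theorem primalIntegral_jumpPrimal_normal (F : M.VectorField) :
    M.primalIntegral (fun e x => N.jumpPrimal (fun τ => vval (F τ) x ⬝ᵥ N.primal e) e) =
      ∑ τ, edgeIntegral (M.primalEdge τ).1 (fun x => vval (F τ) x ⬝ᵥ M.normalPrimal τ) := by
  classical
  rw [← Finset.sum_fiberwise Finset.univ M.primalEdge]
  refine Finset.sum_congr rfl fun e _ => ?_
  simp only [jumpPrimal]
  rw [edgeIntegral_sum _ _ fun τ => by fun_prop]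
  refine Finset.sum_congr (by congr) fun τ hτ => ?_
  obtain rfl := (Finset.mem_filter.1 hτ).2
  conv_rhs => rw [N.normalPrimal_eq τ]
  simp only [dotProduct_smul]

theorem edgeIntegral_jumpDual_normal (F : M.VectorField) (e : M.DualEdge) :
    edgeIntegral (M.dualSym e) (fun x => N.jumpDual (fun τ => vval (F τ) x ⬝ᵥ N.dual e) e) =
      edgeIntegral (M.dualSym e) (fun x => vval (F (M.before e)) x ⬝ᵥ M.normalBefore e) +
      edgeIntegral (M.dualSym e) (fun x => vval (F (M.after e)) x ⬝ᵥ M.normalAfter e) := by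
  rw [← edgeIntegral_add _ (by fun_prop) (by fun_prop), N.normalBefore_eq, N.normalAfter_eq]
  simp only [jumpDual, dotProduct_smul]

theorem integral_dvg (F : M.VectorField) :
    M.integral (fun τ => val (dvg (F τ))) =
      M.primalIntegral (fun e x => N.jumpPrimal (fun τ => vval (F τ) x ⬝ᵥ N.primal e) e) +
      M.dualIntegral (fun e x => N.jumpDual (fun τ => vval (F τ) x ⬝ᵥ N.dual e) e) := by
  have hnext := Equiv.sum_comp M.next fun e : M.Tri =>
    edgeIntegral (M.dualSym e) (fun x => vval (F (M.before e)) x ⬝ᵥ M.normalBefore e)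
  simp only [before_next] at hnext
  simp only [integral, integral_triSet_dvg, primalIntegral_jumpPrimal_normal,
    dualIntegral, edgeIntegral_jumpDual_normal, Finset.sum_add_distrib, hnext, after]
  ring

/-! ### Discrete integration by parts -/

theorem val_side {k : ℕ} {q : M.ScalarField} (hq : q ∈ M.pressureSpace k) (N : M.EdgeNormals)
    (τ : M.Tri) {x : Plane} (hx : x ∈ edgeSet (M.primalEdge τ).1) :
    val (q (M.side (M.primalEdge τ))) x = val (q τ) x := by
  by_cases he : M.IsInteriorEdge (M.primalEdge τ)
  · exact hq.2.1 _ he _ _ (M.primalEdge_side _) rfl x hx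
  · rw [N.side_eq_of_not_isInteriorEdge he]

theorem mval_side_mulVec {k : ℕ} {G : M.TensorField} (hG : G ∈ N.gradientSpace k)
    (τ : M.Tri) {x : Plane} (hx : x ∈ edgeSet (M.primalEdge τ).1) :
    mval (G (M.side (M.primalEdge τ))) x *ᵥ N.primal (M.primalEdge τ) =
      mval (G τ) x *ᵥ N.primal (M.primalEdge τ) := by
  by_cases he : M.IsInteriorEdge (M.primalEdge τ)
  · exact hG.2 _ he _ _ (M.primalEdge_side _) rfl x hx
  · rw [N.side_eq_of_not_isInteriorEdge he]

theorem formbstar_eq_formb {k : ℕ} {v : M.VectorField} (hv : v ∈ N.velocitySpace k)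
    {q : M.ScalarField} (hq : q ∈ M.pressureSpace k) : N.formbstar q v = N.formb v q := by
  have hdvg := N.integral_dvg fun τ => q τ • v τ
  have hvol : M.integral (fun τ => val (dvg (q τ • v τ))) =
      M.integral (fun τ x => vval (v τ) x ⬝ᵥ vval (grad (q τ)) x) +
        M.integral (fun τ x => val (q τ) x * val (dvg (v τ)) x) := by
    simp only [dvg_smul]
    rw [← M.integral_add (fun τ => M.integrableOn_triSet (by fun_prop) τ)
      fun τ => M.integrableOn_triSet (by fun_prop) τ]
    exact M.integral_congr fun τ x => by rw [val_add, val_dotProduct, val_mul]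
  have hprimal : M.primalIntegral (fun e x =>
        N.jumpPrimal (fun τ => vval (q τ • v τ) x ⬝ᵥ N.primal e) e) =
      M.primalIntegral (fun e x => val (q (M.side e)) x *
        N.jumpPrimal (fun τ => vval (v τ) x ⬝ᵥ N.primal e) e) := by
    refine M.primalIntegral_congr fun e x hx => (N.mul_jumpPrimal fun τ hτ => ?_).symm
    subst hτ
    rw [val_side hq N τ hx, vval_poly_smul, smul_dotProduct, smul_eq_mul]
  have hdual : M.dualIntegral (fun e x =>
        N.jumpDual (fun τ => vval (q τ • v τ) x ⬝ᵥ N.dual e) e) =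
      M.dualIntegral (fun e x => (vval (v (M.after e)) x ⬝ᵥ N.dual e) *
        N.jumpDual (fun τ => val (q τ) x) e) := by
    refine M.dualIntegral_congr fun e x hx => ?_
    rw [← N.jumpDual_mul_of_eq (φ := fun τ => vval (v τ) x ⬝ᵥ N.dual e) _ (hv.2 e x hx)]
    simp only [vval_poly_smul, smul_dotProduct, smul_eq_mul, mul_comm]
  rw [formbstar, formb]
  linarith

theorem formB_eq_formBstar {k : ℕ} {v : M.VectorField} (hv : v ∈ N.velocitySpace k)
    {G : M.TensorField} (hG : G ∈ N.gradientSpace k) : N.formB G v = N.formBstar v G := by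
  have hdvg := N.integral_dvg fun τ => v τ ᵥ* G τ
  have hvol : M.integral (fun τ => val (dvg (v τ ᵥ* G τ))) =
      M.integral (fun τ x => vval (v τ) x ⬝ᵥ vval (mdvg (G τ)) x) +
        M.integral (fun τ x => ddot (mval (G τ) x) (mval (vgrad (v τ)) x)) := by
    rw [← M.integral_add (fun τ => M.integrableOn_triSet (by fun_prop) τ)
      fun τ => M.integrableOn_triSet (by fun_prop) τ]
    exact M.integral_congr fun τ x => val_dvg_vecMul _ _ _
  have hprimal : M.primalIntegral (fun e x =>
        N.jumpPrimal (fun τ => vval (v τ ᵥ* G τ) x ⬝ᵥ N.primal e) e) =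
      M.primalIntegral (fun e x => N.jumpPrimal (fun τ => vval (v τ) x) e ⬝ᵥ
        (mval (G (M.side e)) x *ᵥ N.primal e)) := by
    refine M.primalIntegral_congr fun e x hx => (N.jumpPrimal_dotProduct fun τ hτ => ?_).symm
    subst hτ
    rw [N.mval_side_mulVec hG τ hx, dotProduct_mulVec, vval_vecMul]
  have hdual : M.dualIntegral (fun e x =>
        N.jumpDual (fun τ => vval (v τ ᵥ* G τ) x ⬝ᵥ N.dual e) e) =
      M.dualIntegral (fun e x => (vval (v (M.after e)) x ⬝ᵥ N.dual e) *
        (N.dual e ⬝ᵥ N.jumpDual (fun τ => mval (G τ) x *ᵥ N.dual e) e)) +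
      M.dualIntegral (fun e x => N.jumpDual (fun τ => (vval (v τ) x ⬝ᵥ tangent (N.dual e)) *
        (tangent (N.dual e) ⬝ᵥ (mval (G τ) x *ᵥ N.dual e))) e) := by
    rw [← M.dualIntegral_add (fun e => by fun_prop) fun e => by fun_prop]
    refine M.dualIntegral_congr fun e x hx => ?_
    rw [dotProduct_jumpDual, ← N.jumpDual_mul_of_eq
      (φ := fun τ => vval (v τ) x ⬝ᵥ N.dual e) _ (hv.2 e x hx), ← jumpDual_add]
    simp only [vval_vecMul, ← dotProduct_mulVec,
      ← dotProduct_eq_normal_add_tangential (N.dual_isUnitNormal e).1]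
  rw [formB, formBstar]
  linarith

theorem formT_eq_formTstar (G : M.TensorField) (w : M.EdgeField) :
    N.formT G w = N.formTstar w G := by
  simp only [formT, formTstar, dotProduct_comm]

end EdgeNormals
end Mesh

/-! ### Vanishing piecewise polynomials -/

theorem val_C (r : ℝ) (x : Plane) : val (MvPolynomial.C r) x = r := by simp [val]

theorem poly_eq_zero_of_isOpen {U : Set Plane} (hU : IsOpen U) (hne : U.Nonempty) {p : Poly}
    (h : ∀ x ∈ U, val p x = 0) : p = 0 := by
  obtain ⟨x, hx⟩ := hne
  have hV : IsOpen (WithLp.toLp 2 ⁻¹' U : Set (Fin 2 → ℝ)) :=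
    hU.preimage (PiLp.continuous_toLp 2 _)
  obtain ⟨u, hu, hsub⟩ := isOpen_pi_iff'.1 hV x.ofLp hx
  refine MvPolynomial.funext_set u
    (fun i => infinite_of_mem_nhds (x.ofLp i) ((hu i).1.mem_nhds (hu i).2)) fun y hy => ?_
  rw [map_zero]
  exact h (WithLp.toLp 2 y) (hsub hy)

section WeightedIntegral

variable {K : Set Plane} {w : Plane → ℝ}

theorem poly_eq_zero_of_setIntegral_eq_zero (hK : IsCompact K) (hne : (interior K).Nonempty)
    (hw : IntegrableOn w K) (hpos : ∀ᵐ x ∂volume.restrict K, 0 < w x) {p : Poly}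
    (hp : ∀ x ∈ K, 0 ≤ val p x) (h : ∫ x in K, w x * val p x = 0) : p = 0 := by
  have hpK : ∀ᵐ x ∂volume.restrict K, 0 ≤ val p x :=
    (ae_restrict_iff' hK.measurableSet).2 (.of_forall hp)
  have hmul : (fun x => w x * val p x) =ᵐ[volume.restrict K] 0 := by
    refine (setIntegral_eq_zero_iff_of_nonneg_ae ?_
      (hw.mul_continuousOn (continuous_val p).continuousOn hK)).1 h
    filter_upwards [hpos, hpK] with x hwx hpx using mul_nonneg hwx.le hpx
  have hzero : val p =ᵐ[volume.restrict K] 0 := by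
    filter_upwards [hmul, hpos] with x hx hwx using (mul_eq_zero.1 hx).resolve_left hwx.ne'
  exact poly_eq_zero_of_isOpen isOpen_interior hne
    (Measure.eqOn_open_of_ae_eq (ae_restrict_of_ae_restrict_of_subset interior_subset hzero)
      isOpen_interior (continuous_val p).continuousOn continuousOn_const)

theorem poly_eq_zero_of_setIntegral_sum_eq_zero {ι : Type*} [Fintype ι] (hK : IsCompact K)
    (hne : (interior K).Nonempty) (hw : IntegrableOn w K)
    (hpos : ∀ᵐ x ∂volume.restrict K, 0 < w x) {p : ι → Poly} (hp : ∀ i, ∀ x ∈ K, 0 ≤ val (p i) x)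
    (h : ∫ x in K, w x * ∑ i, val (p i) x = 0) (i : ι) : p i = 0 := by
  simp only [← val_sum] at h
  have hsum : ∑ i, p i = 0 := by
    refine poly_eq_zero_of_setIntegral_eq_zero hK hne hw hpos (fun x hx => ?_) h
    rw [val_sum]
    exact Finset.sum_nonneg fun i _ => hp i x hx
  refine poly_eq_zero_of_isOpen isOpen_interior hne fun x hx => ?_
  have hvals : ∑ i, val (p i) x = 0 := by rw [← val_sum, hsum, val, map_zero]
  exact (Finset.sum_eq_zero_iff_of_nonneg fun i _ => hp i x (interior_subset hx)).1 hvals i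
    (Finset.mem_univ i)

end WeightedIntegral

theorem edgeIntegral_nonneg {φ : Plane → ℝ} (hφ : ∀ x, 0 ≤ φ x) (e : Sym2 Plane) :
    0 ≤ edgeIntegral e φ := by
  induction e using Sym2.ind with
  | _ a b =>
    exact mul_nonneg dist_nonneg (intervalIntegral.integral_nonneg zero_le_one fun _ _ => hφ _)

theorem eq_zero_of_edgeIntegral_eq_zero {a b : Plane} (hab : a ≠ b) {φ : Plane → ℝ}
    (hc : Continuous φ) (hφ : ∀ x, 0 ≤ φ x) (h : edgeIntegral s(a, b) φ = 0) {x : Plane}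
    (hx : x ∈ edgeSet s(a, b)) : φ x = 0 := by
  rw [edgeSet_mk, segment_eq_image_lineMap] at hx
  obtain ⟨s, hs, rfl⟩ := hx
  by_contra hne
  have hpos : 0 < ∫ s in (0 : ℝ)..1, φ (AffineMap.lineMap a b s) :=
    intervalIntegral.integral_pos zero_lt_one
      (hc.comp AffineMap.lineMap_continuous).continuousOn (fun _ _ => hφ _)
      ⟨s, hs, (hφ _).lt_of_ne' hne⟩
  exact (mul_pos (dist_pos.2 hab) hpos).ne' h

theorem eq_C_of_pderiv_eq_zero {p : Poly} (h : ∀ j, MvPolynomial.pderiv j p = 0) :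
    p = MvPolynomial.C (MvPolynomial.coeff 0 p) := by
  ext m
  rw [MvPolynomial.coeff_C]
  split_ifs with hm
  · rw [hm]
  · obtain ⟨j, hj⟩ : ∃ j, m j ≠ 0 := by
      by_contra! h0
      exact hm (Finsupp.ext fun j => (h0 j).symm)
    have hle : Finsupp.single j 1 ≤ m := by simpa using Nat.one_le_iff_ne_zero.2 hj
    have hcoeff := MvPolynomial.coeff_pderiv (i := j) p (m - Finsupp.single j 1)
    rw [h j, MvPolynomial.coeff_zero, tsub_add_cancel_of_le hle] at hcoeff
    exact (mul_eq_zero.1 hcoeff.symm).resolve_right (by positivity)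

namespace Mesh

variable {Ω : Set Plane} (M : Mesh Ω)

theorem poly_eq_zero_of_integral_sum_eq_zero {ι : Type*} [Fintype ι] {w : Plane → ℝ}
    (hw : ∀ τ, IntegrableOn w (M.triSet τ))
    (hpos : ∀ τ, ∀ᵐ x ∂volume.restrict (M.triSet τ), 0 < w x) {p : M.Tri → ι → Poly}
    (hp : ∀ τ i, ∀ x ∈ M.triSet τ, 0 ≤ val (p τ i) x)
    (h : M.integral (fun τ x => w x * ∑ i, val (p τ i) x) = 0) (τ : M.Tri) (i : ι) :
    p τ i = 0 := by
  have hnonneg : ∀ τ, 0 ≤ ∫ x in M.triSet τ, w x * ∑ i, val (p τ i) x := fun τ => by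
    refine setIntegral_nonneg_of_ae_restrict ?_
    filter_upwards [hpos τ, ae_restrict_mem (M.isCompact_triSet τ).measurableSet] with x hwx hx
    exact mul_nonneg hwx.le (Finset.sum_nonneg fun i _ => hp τ i x hx)
  exact poly_eq_zero_of_setIntegral_sum_eq_zero (M.isCompact_triSet τ)
    (interior_triangle_nonempty (M.triDet_center_ne_zero τ)) (hw τ) (hpos τ) (hp τ)
    ((Finset.sum_eq_zero_iff_of_nonneg fun τ _ => hnonneg τ).1 h τ (Finset.mem_univ τ)) i

theorem eq_zero_of_dualIntegral_eq_zero {φ : M.DualEdge → Plane → ℝ}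
    (hc : ∀ e, Continuous (φ e)) (hφ : ∀ e x, 0 ≤ φ e x) (h : M.dualIntegral φ = 0)
    {e : M.DualEdge} {x : Plane} (hx : x ∈ edgeSet (M.dualSym e)) : φ e x = 0 :=
  eq_zero_of_edgeIntegral_eq_zero (M.center_ne_vertex e) (hc e) (hφ e)
    ((Finset.sum_eq_zero_iff_of_nonneg fun e _ => edgeIntegral_nonneg (hφ e) _).1 h e
      (Finset.mem_univ e)) hx

end Mesh

/-! ### Velocities with prescribed fluxes through the dual edges -/

/-- The affine function that vanishes on the line through `a`, `b` and takes the value `1` at `c`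
(junk value `0` when the three points are collinear). -/
def baryPoly (a b c : Plane) : Poly :=
  (triDet a b c)⁻¹ • ((b 0 - a 0) • (MvPolynomial.X 1 - MvPolynomial.C (a 1)) -
    (b 1 - a 1) • (MvPolynomial.X 0 - MvPolynomial.C (a 0)))

theorem val_baryPoly (a b c x : Plane) :
    val (baryPoly a b c) x = triDet a b x / triDet a b c := by
  simp only [val, baryPoly, MvPolynomial.smul_eval, map_sub, MvPolynomial.eval_C,
    MvPolynomial.eval_X, triDet, div_eq_inv_mul]

theorem totalDegree_smul_X_sub_C_le (s : ℝ) (i : Fin 2) (r : ℝ) :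
    (s • (MvPolynomial.X i - MvPolynomial.C r) : Poly).totalDegree ≤ 1 :=
  (MvPolynomial.totalDegree_smul_le _ _).trans
    ((MvPolynomial.totalDegree_sub_C_le _ _).trans (MvPolynomial.totalDegree_X _).le)

theorem totalDegree_baryPoly (a b c : Plane) : (baryPoly a b c).totalDegree ≤ 1 :=
  (MvPolynomial.totalDegree_smul_le _ _).trans ((MvPolynomial.totalDegree_sub _ _).trans
    (max_le (totalDegree_smul_X_sub_C_le _ _ _) (totalDegree_smul_X_sub_C_le _ _ _)))

theorem baryPoly_ne_zero {a b c : Plane} (h : triDet a b c ≠ 0) : baryPoly a b c ≠ 0 := by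
  intro h0
  have hc := val_baryPoly a b c c
  rw [h0, div_self h, val, map_zero] at hc
  exact zero_ne_one hc

theorem val_baryPoly_eq_zero {a b c x : Plane} (hx : x ∈ edgeSet s(a, b)) :
    val (baryPoly a b c) x = 0 := by
  rw [edgeSet_mk, segment_eq_image_lineMap] at hx
  obtain ⟨s, -, rfl⟩ := hx
  rw [val_baryPoly, div_eq_zero_iff]
  left
  simp only [triDet, AffineMap.lineMap_apply_module', PiLp.add_apply, PiLp.smul_apply,
    PiLp.sub_apply, smul_eq_mul]
  ring

theorem val_baryPoly_nonneg {a b c x : Plane} (h : triDet a b c ≠ 0)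
    (hx : x ∈ convexHull ℝ ({a, b, c} : Set Plane)) : 0 ≤ val (baryPoly a b c) x := by
  obtain ⟨s, t, -, ht, -, rfl⟩ := mem_convexHull_triple.1 hx
  rwa [val_baryPoly, triDet_triPoint_right, mul_div_cancel_right₀ _ h]

/-- The derivative of a polynomial in the direction `d`. -/
def dirDeriv (d : Fin 2 → ℝ) (p : Poly) : Poly := ∑ j, d j • MvPolynomial.pderiv j p

theorem val_dirDeriv (d : Fin 2 → ℝ) (p : Poly) (x : Plane) :
    val (dirDeriv d p) x = d ⬝ᵥ vval (grad p) x := by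
  simp only [dirDeriv, val_sum, val_smul, dotProduct, vval, grad]

theorem totalDegree_pderiv_lt {p : Poly} {j : Fin 2} (h : MvPolynomial.pderiv j p ≠ 0) :
    (MvPolynomial.pderiv j p).totalDegree < p.totalDegree := by
  have hsupp : ∀ m ∈ (MvPolynomial.pderiv j p).support,
      (m.sum fun _ e => e) + 1 ≤ p.totalDegree := fun m hm => by
    rw [MvPolynomial.mem_support_iff, MvPolynomial.coeff_pderiv] at hm
    have hle := MvPolynomial.le_totalDegree
      (MvPolynomial.mem_support_iff.2 (left_ne_zero_of_mul hm))
    rwa [Finsupp.sum_add_index' (by simp) (by simp), Finsupp.sum_single_index rfl] at hle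
  obtain ⟨m, hm⟩ := MvPolynomial.support_nonempty.2 h
  exact (Finset.sup_lt_iff (Nat.lt_of_lt_of_le (Nat.succ_pos _) (hsupp m hm))).2 hsupp

theorem mul_dirDeriv_mem {k : ℕ} {l p : Poly} (hl : l.totalDegree ≤ 1)
    (hp : p ∈ MvPolynomial.restrictTotalDegree (Fin 2) ℝ k) (d : Fin 2 → ℝ) :
    l * dirDeriv d p ∈ MvPolynomial.restrictTotalDegree (Fin 2) ℝ k := by
  rw [dirDeriv, Finset.mul_sum]
  refine Submodule.sum_mem _ fun j _ => ?_
  rw [mul_smul_comm]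
  refine Submodule.smul_mem _ _ ?_
  rw [MvPolynomial.mem_restrictTotalDegree] at hp ⊢
  by_cases h0 : MvPolynomial.pderiv j p = 0
  · simp [h0]
  have hlt := totalDegree_pderiv_lt h0
  have hmul := MvPolynomial.totalDegree_mul l (MvPolynomial.pderiv j p)
  omega

namespace Mesh

variable {Ω : Set Plane} {M : Mesh Ω}

theorem triDet_center_swap_ne_zero (M : Mesh Ω) (τ : M.Tri) :
    triDet (M.center τ.1) (M.snd τ) (M.fst τ) ≠ 0 := by
  rw [triDet_swap, neg_ne_zero]
  exact M.triDet_center_ne_zero τ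

theorem next_before (e : M.DualEdge) : M.next (M.before e) = e := by
  obtain ⟨τ, rfl⟩ := M.next.surjective e
  rw [M.before_next]

namespace EdgeNormals

variable (N : M.EdgeNormals)

/-- The vector with unit flux through the first dual edge of a triangle and none through the
second: a multiple of the direction of the second dual edge. -/
def frameFst (τ : M.Tri) : Fin 2 → ℝ :=
  (N.dual τ ⬝ᵥ (M.snd τ - M.center τ.1).ofLp)⁻¹ • (M.snd τ - M.center τ.1).ofLp

/-- The vector with unit flux through the second dual edge of a triangle and none through the
first: a multiple of the direction of the first dual edge. -/
def frameSnd (τ : M.Tri) : Fin 2 → ℝ :=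
  (N.dual (M.next τ) ⬝ᵥ (M.fst τ - M.center τ.1).ofLp)⁻¹ • (M.fst τ - M.center τ.1).ofLp

theorem dual_dotProduct_snd_ne_zero (τ : M.Tri) :
    N.dual τ ⬝ᵥ (M.snd τ - M.center τ.1).ofLp ≠ 0 :=
  (N.dual_isUnitNormal τ).dotProduct_sub_ne_zero (M.triDet_center_ne_zero τ)

theorem dual_next_dotProduct_fst_ne_zero (τ : M.Tri) :
    N.dual (M.next τ) ⬝ᵥ (M.fst τ - M.center τ.1).ofLp ≠ 0 :=
  (N.dual_isUnitNormal (M.next τ)).dotProduct_sub_ne_zero (M.triDet_center_swap_ne_zero τ)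

theorem dual_dotProduct_fst (τ : M.Tri) : N.dual τ ⬝ᵥ (M.fst τ - M.center τ.1).ofLp = 0 :=
  (N.dual_isUnitNormal τ).2

theorem dual_next_dotProduct_snd (τ : M.Tri) :
    N.dual (M.next τ) ⬝ᵥ (M.snd τ - M.center τ.1).ofLp = 0 :=
  (N.dual_isUnitNormal (M.next τ)).2

/-- The vector field whose fluxes through the two dual edges of the triangle `τ` are `φ τ` and
`ψ τ`. -/
def fluxField (φ ψ : M.Tri → Poly) : M.VectorField :=
  fun τ i => N.frameFst τ i • φ τ + N.frameSnd τ i • ψ τ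

theorem vval_fluxField (φ ψ : M.Tri → Poly) (τ : M.Tri) (x : Plane) :
    vval (N.fluxField φ ψ τ) x =
      val (φ τ) x • N.frameFst τ + val (ψ τ) x • N.frameSnd τ := by
  funext i
  simp only [vval, fluxField, val_add, val_smul, Pi.add_apply, Pi.smul_apply, smul_eq_mul,
    mul_comm]

theorem fluxField_dual (φ ψ : M.Tri → Poly) (τ : M.Tri) (x : Plane) :
    vval (N.fluxField φ ψ τ) x ⬝ᵥ N.dual τ = val (φ τ) x := by
  rw [vval_fluxField, dotProduct_comm, dotProduct_add, frameFst, frameSnd]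
  simp only [dotProduct_smul, dual_dotProduct_fst, mul_zero, add_zero, smul_eq_mul,
    inv_mul_cancel₀ (N.dual_dotProduct_snd_ne_zero τ), mul_one]

theorem fluxField_dual_next (φ ψ : M.Tri → Poly) (τ : M.Tri) (x : Plane) :
    vval (N.fluxField φ ψ τ) x ⬝ᵥ N.dual (M.next τ) = val (ψ τ) x := by
  rw [vval_fluxField, dotProduct_comm, dotProduct_add, frameFst, frameSnd]
  simp only [dotProduct_smul, dual_next_dotProduct_snd, mul_zero, zero_add, smul_eq_mul,
    inv_mul_cancel₀ (N.dual_next_dotProduct_fst_ne_zero τ), mul_one]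

theorem fluxField_mem {k : ℕ} {φ ψ : M.Tri → Poly}
    (hφ : ∀ τ, φ τ ∈ MvPolynomial.restrictTotalDegree (Fin 2) ℝ k)
    (hψ : ∀ τ, ψ τ ∈ MvPolynomial.restrictTotalDegree (Fin 2) ℝ k)
    (h : ∀ e, ∀ x ∈ edgeSet (M.dualSym e), val (ψ (M.before e)) x = val (φ e) x) :
    N.fluxField φ ψ ∈ N.velocitySpace k := by
  refine ⟨fun τ i => Submodule.add_mem _ (Submodule.smul_mem _ _ (hφ τ))
    (Submodule.smul_mem _ _ (hψ τ)), fun e x hx => ?_⟩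
  have hnext := N.fluxField_dual_next φ ψ (M.before e) x
  rw [next_before] at hnext
  rw [hnext, after, fluxField_dual, h e x hx]

/-! ### Pressures in the kernel of `b_h` are cellwise constant -/

/-- A velocity without flux through the dual edges whose product with `∇q` is a sum of squares
of derivatives of `q` with the barycentric coordinates as weights. -/
def gradTestField (q : M.ScalarField) : M.VectorField :=
  N.fluxField
    (fun τ => baryPoly (M.center τ.1) (M.fst τ) (M.snd τ) * dirDeriv (N.frameFst τ) (q τ))
    (fun τ => baryPoly (M.center τ.1) (M.snd τ) (M.fst τ) * dirDeriv (N.frameSnd τ) (q τ))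

theorem gradTestField_mem {k : ℕ} {q : M.ScalarField}
    (hq : ∀ τ, q τ ∈ MvPolynomial.restrictTotalDegree (Fin 2) ℝ k) :
    N.gradTestField q ∈ N.velocitySpace k := by
  refine N.fluxField_mem (fun τ => mul_dirDeriv_mem (totalDegree_baryPoly _ _ _) (hq τ) _)
    (fun τ => mul_dirDeriv_mem (totalDegree_baryPoly _ _ _) (hq τ) _) fun e x hx => ?_
  rw [val_mul, val_mul, M.snd_before]
  exact (mul_eq_zero_of_left (val_baryPoly_eq_zero hx) _).trans
    (mul_eq_zero_of_left (val_baryPoly_eq_zero hx) _).symm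

theorem gradTestField_dual (q : M.ScalarField) {e : M.DualEdge} {x : Plane}
    (hx : x ∈ edgeSet (M.dualSym e)) : vval (N.gradTestField q e) x ⬝ᵥ N.dual e = 0 := by
  rw [gradTestField, fluxField_dual, val_mul]
  exact mul_eq_zero_of_left (val_baryPoly_eq_zero hx) _

theorem gradTestField_dotProduct_grad (q : M.ScalarField) (τ : M.Tri) (x : Plane) :
    vval (N.gradTestField q τ) x ⬝ᵥ vval (grad (q τ)) x =
      ∑ i, val (![
        baryPoly (M.center τ.1) (M.fst τ) (M.snd τ) * dirDeriv (N.frameFst τ) (q τ) ^ 2,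
        baryPoly (M.center τ.1) (M.snd τ) (M.fst τ) * dirDeriv (N.frameSnd τ) (q τ) ^ 2] i) x := by
  rw [gradTestField, vval_fluxField, add_dotProduct, smul_dotProduct, smul_dotProduct,
    ← val_dirDeriv, ← val_dirDeriv]
  simp only [Fin.sum_univ_two, cons_val_zero, cons_val_one, val_mul, smul_eq_mul, pow_two,
    mul_assoc]

theorem dirDeriv_frame_eq_zero_of_formb {k : ℕ} {q : M.ScalarField}
    (hq : ∀ τ, q τ ∈ MvPolynomial.restrictTotalDegree (Fin 2) ℝ k)
    (h : ∀ v ∈ N.velocitySpace k, N.formb v q = 0) (τ : M.Tri) :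
    dirDeriv (N.frameFst τ) (q τ) = 0 ∧ dirDeriv (N.frameSnd τ) (q τ) = 0 := by
  have hform := h _ (N.gradTestField_mem hq)
  have hdual : M.dualIntegral (fun e x => (vval (N.gradTestField q (M.after e)) x ⬝ᵥ N.dual e) *
      N.jumpDual (fun τ => val (q τ) x) e) = M.dualIntegral fun _ _ => 0 * 0 :=
    M.dualIntegral_congr fun e x hx => by rw [after, N.gradTestField_dual q hx, zero_mul, zero_mul]
  rw [formb, hdual, M.dualIntegral_const_mul, zero_mul, sub_zero] at hform
  have hzero := M.poly_eq_zero_of_integral_sum_eq_zero (w := fun _ => 1)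
    (p := fun τ => ![
      baryPoly (M.center τ.1) (M.fst τ) (M.snd τ) * dirDeriv (N.frameFst τ) (q τ) ^ 2,
      baryPoly (M.center τ.1) (M.snd τ) (M.fst τ) * dirDeriv (N.frameSnd τ) (q τ) ^ 2])
    (fun τ => M.integrableOn_triSet continuous_const τ) (fun τ => .of_forall fun _ => one_pos)
    (fun τ => Fin.forall_fin_two.2 ⟨fun x hx => ?_, fun x hx => ?_⟩)
    (by simpa only [one_mul, gradTestField_dotProduct_grad] using hform) τ
  · have hd : ∀ {l d : Poly}, l ≠ 0 → l * d ^ 2 = 0 → d = 0 := fun hl h =>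
      pow_eq_zero_iff two_ne_zero |>.1 ((mul_eq_zero.1 h).resolve_left hl)
    exact ⟨hd (baryPoly_ne_zero (M.triDet_center_ne_zero τ)) (hzero 0),
      hd (baryPoly_ne_zero (M.triDet_center_swap_ne_zero τ)) (hzero 1)⟩
  · rw [cons_val_zero, val_mul, pow_two, val_mul]
    exact mul_nonneg (val_baryPoly_nonneg (M.triDet_center_ne_zero τ) hx) (mul_self_nonneg _)
  · rw [triSet, Set.pair_comm] at hx
    rw [cons_val_one, cons_val_zero, val_mul, pow_two, val_mul]
    exact mul_nonneg (val_baryPoly_nonneg (M.triDet_center_swap_ne_zero τ) hx) (mul_self_nonneg _)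

theorem grad_eq_zero_of_formb {k : ℕ} {q : M.ScalarField}
    (hq : ∀ τ, q τ ∈ MvPolynomial.restrictTotalDegree (Fin 2) ℝ k)
    (h : ∀ v ∈ N.velocitySpace k, N.formb v q = 0) (τ : M.Tri) : grad (q τ) = 0 := by
  obtain ⟨hfst, hsnd⟩ := N.dirDeriv_frame_eq_zero_of_formb hq h τ
  have hval : ∀ x, vval (grad (q τ)) x = 0 := fun x => by
    have hfst' := val_dirDeriv (N.frameFst τ) (q τ) x
    have hsnd' := val_dirDeriv (N.frameSnd τ) (q τ) x
    rw [hfst, frameFst, smul_dotProduct, val, map_zero, eq_comm, smul_eq_zero_iff_right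
      (inv_ne_zero (N.dual_dotProduct_snd_ne_zero τ)), dotProduct_comm] at hfst'
    rw [hsnd, frameSnd, smul_dotProduct, val, map_zero, eq_comm, smul_eq_zero_iff_right
      (inv_ne_zero (N.dual_next_dotProduct_fst_ne_zero τ)), dotProduct_comm] at hsnd'
    exact eq_of_dotProduct_sides_eq (M.triDet_center_ne_zero τ)
      (by rw [zero_dotProduct]; exact hsnd') (by rw [zero_dotProduct]; exact hfst')
  exact funext fun j => poly_eq_zero_of_isOpen isOpen_univ Set.univ_nonempty
    fun x _ => congrFun (hval x) j

theorem before_eq_after_of_formb {k : ℕ} {c : M.Tri → ℝ}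
    (h : ∀ v ∈ N.velocitySpace k, N.formb v (fun τ => MvPolynomial.C (c τ)) = 0)
    (e : M.DualEdge) : c (M.before e) = c (M.after e) := by
  have hdeg : ∀ r : ℝ, (MvPolynomial.C r : Poly) ∈
      MvPolynomial.restrictTotalDegree (Fin 2) ℝ k := fun r => by
    simp only [MvPolynomial.mem_restrictTotalDegree, MvPolynomial.totalDegree_C, zero_le]
  have hform := h _ (N.fluxField_mem (φ := fun e => MvPolynomial.C (N.jumpDual c e))
    (ψ := fun τ => MvPolynomial.C (N.jumpDual c (M.next τ))) (fun τ => hdeg _) (fun τ => hdeg _)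
    fun e x _ => by rw [next_before])
  have hgrad : ∀ r x, vval (grad (MvPolynomial.C r)) x = 0 := fun r x => by
    funext j
    simp [vval, grad, val]
  have hsq : M.dualIntegral (fun e _ => N.jumpDual c e * N.jumpDual c e) = 0 := by
    simpa only [formb, hgrad, dotProduct_zero, integral, MeasureTheory.integral_zero,
      Finset.sum_const_zero, zero_sub, neg_eq_zero, after, fluxField_dual, val_C] using hform
  have hjump : N.jumpDual c e = 0 := mul_self_eq_zero.1 <|
    M.eq_zero_of_dualIntegral_eq_zero (fun _ => continuous_const) (fun _ _ => mul_self_nonneg _)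
      hsq (e := e) (x := M.center e.1) (by
        rw [dualSym, edgeSet_mk]
        exact left_mem_segment ℝ _ _)
  rw [jumpDual_eq_smul_sub, smul_eq_zero_iff_right (N.normalAfter_dotProduct_ne_zero e)] at hjump
  exact (sub_eq_zero.1 hjump).symm

end EdgeNormals

end Mesh

/-! ### Propagation of constants through the mesh -/

section Connected

variable {E : Type*} [NormedAddCommGroup E] [NormedSpace ℝ E]

theorem isPreconnected_ball_diff_singleton (hrank : 1 < Module.rank ℝ E) (x : E) {r : ℝ}
    (hr : 0 < r) : IsPreconnected (Metric.ball x r \ {x}) := by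
  set φ := OpenPartialHomeomorph.univBall x r
  have hsource : φ.source = Set.univ := OpenPartialHomeomorph.univBall_source x r
  have hinj : Function.Injective φ := Set.injOn_univ.1 (hsource ▸ φ.injOn)
  have himage : φ '' {0}ᶜ = Metric.ball x r \ {x} := by
    rw [Set.compl_eq_univ_sdiff, Set.image_sdiff hinj, Set.image_singleton, ← hsource,
      φ.image_source_eq_target, OpenPartialHomeomorph.univBall_target x hr,
      OpenPartialHomeomorph.univBall_apply_zero]
  rw [← himage]
  exact (isConnected_compl_singleton_of_one_lt_rank hrank 0).isPreconnected.image _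
    (OpenPartialHomeomorph.continuous_univBall x r).continuousOn

theorem isPreconnected_diff_singleton (hrank : 1 < Module.rank ℝ E) {U : Set E} (hU : IsOpen U)
    (hc : IsPreconnected U) (x : E) : IsPreconnected (U \ {x}) := by
  classical
  by_cases hx : x ∈ U
  swap
  · rwa [Set.sdiff_singleton_eq_self hx]
  obtain ⟨r, hr, hball⟩ := Metric.isOpen_iff.1 hU x hx
  refine isPreconnected_of_forall_constant fun F hF y hy z hz => ?_
  obtain ⟨b, hb⟩ : ∃ b, ∀ w ∈ Metric.ball x r \ {x}, F w = b := by
    by_contra! hne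
    obtain ⟨w, hw, hwb⟩ := hne true
    obtain ⟨w', hw', hwb'⟩ := hne false
    have heq := (isPreconnected_ball_diff_singleton hrank x hr).constant
      (hF.mono (Set.sdiff_subset_sdiff_left hball)) hw hw'
    simp_all
  have hext : ContinuousOn (Function.update F x b) U := fun w hw => by
    refine ContinuousAt.continuousWithinAt ?_
    rcases eq_or_ne w x with rfl | hwx
    · refine (continuousAt_const (y := b)).congr ?_
      filter_upwards [Metric.ball_mem_nhds w hr] with w' hw'
      rcases eq_or_ne w' w with rfl | hne
      · rw [Function.update_self]
      · rw [Function.update_of_ne hne, hb w' ⟨hw', hne⟩]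
    · rw [continuousAt_update_of_ne hwx]
      exact hF.continuousAt ((hU.sdiff isClosed_singleton).mem_nhds ⟨hw, hwx⟩)
  simpa only [Function.update_of_ne hy.2, Function.update_of_ne hz.2] using
    hc.constant hext hy.1 hz.1

theorem isPreconnected_diff_finite (hrank : 1 < Module.rank ℝ E) {U V : Set E} (hU : IsOpen U)
    (hc : IsPreconnected U) (hV : V.Finite) : IsPreconnected (U \ V) := by
  induction V, hV using Set.Finite.induction_on with
  | empty => rwa [Set.sdiff_empty]
  | @insert x V _ hV ih =>
    rw [← Set.union_singleton, ← Set.sdiff_sdiff]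
    exact isPreconnected_diff_singleton hrank (hU.sdiff hV.isClosed) ih x

end Connected

theorem eq_of_finRotate_eq {X : Type*} {n : ℕ} {h : Fin n → X} (hr : ∀ i, h (finRotate n i) = h i)
    (i j : Fin n) : h i = h j := by
  cases n with
  | zero => exact i.elim0
  | succ n =>
    have hzero : ∀ i, h i = h 0 := fun i => by
      induction i using Fin.induction with
      | zero => rfl
      | succ i ih => rw [← ih, ← hr i.castSucc, finRotate_apply, Fin.coeSucc_eq_succ]
    rw [hzero i, hzero j]

namespace Mesh

variable {Ω : Set Plane} (M : Mesh Ω)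

theorem interior_triSet_nonempty (τ : M.Tri) : (interior (M.triSet τ)).Nonempty :=
  interior_triangle_nonempty (M.triDet_center_ne_zero τ)

theorem triSet_subset_closure_interior (τ : M.Tri) :
    M.triSet τ ⊆ closure (interior (M.triSet τ)) :=
  subset_closure.trans ((convex_convexHull ℝ _).closure_interior_eq_closure_of_nonempty_interior
    (M.interior_triSet_nonempty τ)).ge

theorem interior_triSet_subset (hΩ : interior (closure Ω) = Ω) (τ : M.Tri) :
    interior (M.triSet τ) ⊆ Ω := by
  have h : M.triSet τ ⊆ closure Ω := M.cover ▸ Set.subset_iUnion M.triSet τ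
  exact (interior_mono h).trans hΩ.subset

theorem eq_of_center_mem {c : M.Cell} {τ : M.Tri} (h : M.center c ∈ M.triSet τ) : τ.1 = c := by
  by_contra hne
  obtain ⟨y, hyc, hyτ⟩ := mem_closure_iff.1 (M.triSet_subset_closure_interior τ h) _
    isOpen_interior (M.center_mem_interior c)
  obtain ⟨i, hi⟩ := Set.mem_iUnion.1 (interior_subset hyc)
  obtain ⟨z, hzτ, hzi⟩ := mem_closure_iff.1 (M.triSet_subset_closure_interior ⟨c, i⟩ hi) _
    isOpen_interior hyτ
  exact (M.disjoint_interior τ ⟨c, i⟩ fun h => hne (congrArg Sigma.fst h)).le_bot ⟨hzτ, hzi⟩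

/-- The vertices of a triangle. -/
def corners (τ : M.Tri) : Set Plane := {M.center τ.1, M.fst τ, M.snd τ}

/-- The vertices of the triangulation. -/
def vertices : Set Plane := ⋃ τ, M.corners τ

theorem finite_vertices : M.vertices.Finite := Set.finite_iUnion fun _ => Set.toFinite {_, _, _}

theorem corners_inter_subset {τ τ' : M.Tri} (hne : τ.1 ≠ τ'.1) :
    M.corners τ ∩ M.corners τ' ⊆ {M.fst τ, M.snd τ} := by
  rintro y ⟨rfl | hy, hy'⟩
  · exact absurd (M.eq_of_center_mem (τ := τ') (subset_convexHull ℝ _ hy')).symm hne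
  · exact hy

theorem side_subset_corners_inter {τ τ' : M.Tri} (hne : τ.1 ≠ τ'.1) {x : Plane}
    (hx : x ∈ M.triSet τ) (hx' : x ∈ M.triSet τ') (hv : x ∉ M.vertices) :
    {M.fst τ, M.snd τ} ⊆ M.corners τ ∩ M.corners τ' := by
  have hmem : x ∈ convexHull ℝ (M.corners τ ∩ M.corners τ') :=
    M.conforming τ τ' (fun h => hne (congrArg Sigma.fst h)) ⟨hx, hx'⟩
  have hsingleton : ∀ y ∈ M.corners τ, ¬ M.corners τ ∩ M.corners τ' ⊆ {y} := fun y hy hsub => by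
    have hxy := convexHull_mono hsub hmem
    rw [convexHull_singleton] at hxy
    exact hv (Set.mem_iUnion.2 ⟨τ, hxy ▸ hy⟩)
  have hfst : M.fst τ ∈ M.corners τ := Or.inr (Or.inl rfl)
  have hsnd : M.snd τ ∈ M.corners τ := Or.inr (Or.inr rfl)
  rintro y (rfl | rfl) <;> by_contra hy
  · exact hsingleton _ hsnd fun z hz => (M.corners_inter_subset hne hz).resolve_left
      fun h => hy (h ▸ hz)
  · exact hsingleton _ hfst fun z hz => (M.corners_inter_subset hne hz).resolve_right
      fun h => hy (h ▸ hz)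

theorem primalEdge_eq_of_mem {τ τ' : M.Tri} (hne : τ.1 ≠ τ'.1) {x : Plane} (hx : x ∈ M.triSet τ)
    (hx' : x ∈ M.triSet τ') (hv : x ∉ M.vertices) : M.primalEdge τ = M.primalEdge τ' := by
  have hsub : {M.fst τ, M.snd τ} ⊆ ({M.fst τ', M.snd τ'} : Set Plane) :=
    (M.side_subset_corners_inter hne hx hx' hv).trans
      (Set.inter_comm _ _ ▸ M.corners_inter_subset hne.symm)
  refine Subtype.ext (Sym2.eq_iff.2 ?_)
  have hside := M.fst_ne_snd τ
  rcases hsub (Or.inl rfl) with hf | hf <;> rcases hsub (Or.inr rfl) with hs | hs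
  · exact absurd (hf.trans hs.symm) hside
  · exact Or.inl ⟨hf, hs⟩
  · exact Or.inr ⟨hf, hs⟩
  · exact absurd (hf.trans hs.symm) hside

theorem mem_primalEdge_of_mem {τ τ' : M.Tri} (hne : τ.1 ≠ τ'.1) {x : Plane} (hx : x ∈ M.triSet τ)
    (hx' : x ∈ M.triSet τ') : x ∈ edgeSet (M.primalEdge τ).1 := by
  have hmem := convexHull_mono (M.corners_inter_subset hne)
    (M.conforming τ τ' (fun h => hne (congrArg Sigma.fst h)) ⟨hx, hx'⟩)
  rw [convexHull_pair] at hmem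
  rwa [primalEdge, edgeSet_mk]

theorem eq_of_fst_eq {X : Type*} {c : M.Tri → X} (hdual : ∀ e, c (M.before e) = c (M.after e))
    {τ τ' : M.Tri} (h : τ.1 = τ'.1) : c τ = c τ' := by
  obtain ⟨a, i⟩ := τ
  obtain ⟨b, j⟩ := τ'
  obtain rfl : a = b := h
  refine eq_of_finRotate_eq (h := fun i => c ⟨a, i⟩) (fun i => ?_) i j
  have hnext := hdual (M.next ⟨a, i⟩)
  rw [M.before_next] at hnext
  exact hnext.symm

theorem exists_mem_triSet_diff_vertices (hΩ : interior (closure Ω) = Ω) (τ : M.Tri) :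
    ∃ x ∈ Ω \ M.vertices, x ∈ M.triSet τ := by
  obtain ⟨y, hy⟩ := M.interior_triSet_nonempty τ
  obtain ⟨x, hx, hxv⟩ := (infinite_of_mem_nhds y
    (isOpen_interior.mem_nhds hy)).exists_notMem_finite M.finite_vertices
  exact ⟨x, ⟨M.interior_triSet_subset hΩ τ hx, hxv⟩, interior_subset hx⟩

theorem eq_of_eq_on_common_points (hΩ : interior (closure Ω) = Ω) (hconn : IsPreconnected Ω)
    {X : Type*} {c : M.Tri → X} (h : ∀ τ τ', ∀ x ∈ Ω \ M.vertices, x ∈ M.triSet τ →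
      x ∈ M.triSet τ' → c τ = c τ') (τ τ' : M.Tri) : c τ = c τ' := by
  have hrank : 1 < Module.rank ℝ Plane := by
    rw [← Module.finrank_eq_rank, finrank_euclideanSpace_fin]
    norm_num
  have hpre := isPreconnected_diff_finite hrank (hΩ ▸ isOpen_interior) hconn M.finite_vertices
  have hclosed : ∀ P : M.Tri → Prop, IsClosed (⋃ σ : {σ // P σ}, M.triSet σ.1) := fun P =>
    isClosed_iUnion_of_finite fun σ => (M.isCompact_triSet σ.1).isClosed
  have hcover : Ω \ M.vertices ⊆
      (⋃ σ : {σ // c σ = c τ}, M.triSet σ.1) ∪ ⋃ σ : {σ // c σ ≠ c τ}, M.triSet σ.1 := by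
    intro z hz
    obtain ⟨σ, hσ⟩ := Set.mem_iUnion.1 (M.cover.ge (subset_closure hz.1))
    exact (em (c σ = c τ)).imp (fun h => Set.mem_iUnion.2 ⟨⟨σ, h⟩, hσ⟩)
      fun h => Set.mem_iUnion.2 ⟨⟨σ, h⟩, hσ⟩
  by_contra hne
  obtain ⟨x, hx, hxτ⟩ := M.exists_mem_triSet_diff_vertices hΩ τ
  obtain ⟨x', hx', hxτ'⟩ := M.exists_mem_triSet_diff_vertices hΩ τ'
  obtain ⟨y, hy, hyeq, hyne⟩ := isPreconnected_closed_iff.1 hpre _ _ (hclosed _) (hclosed _) hcover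
    ⟨x, hx, Set.mem_iUnion.2 ⟨⟨τ, rfl⟩, hxτ⟩⟩
    ⟨x', hx', Set.mem_iUnion.2 ⟨⟨τ', Ne.symm hne⟩, hxτ'⟩⟩
  obtain ⟨⟨σ, hσ⟩, hyσ⟩ := Set.mem_iUnion.1 hyeq
  obtain ⟨⟨σ', hσ'⟩, hyσ'⟩ := Set.mem_iUnion.1 hyne
  exact hσ' ((h σ' σ y hy hyσ' hyσ).trans hσ)

theorem eq_of_no_jumps (hΩ : interior (closure Ω) = Ω) (hconn : IsPreconnected Ω) {X : Type*}
    {c : M.Tri → X} (hdual : ∀ e, c (M.before e) = c (M.after e))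
    (hprimal : ∀ τ τ', M.primalEdge τ = M.primalEdge τ' → M.IsInteriorEdge (M.primalEdge τ) →
      c τ = c τ') (τ τ' : M.Tri) : c τ = c τ' := by
  refine M.eq_of_eq_on_common_points hΩ hconn (fun σ σ' x hx h h' => ?_) τ τ'
  by_cases hne : σ.1 = σ'.1
  · exact M.eq_of_fst_eq hdual hne
  · refine hprimal _ _ (M.primalEdge_eq_of_mem hne h h' hx.2) fun hsub => ?_
    have hfrontier := hsub (M.mem_primalEdge_of_mem hne h h')
    rw [(hΩ ▸ isOpen_interior : IsOpen Ω).frontier_eq] at hfrontier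
    exact hfrontier.2 hx.1

theorem measureReal_triSet_pos (τ : M.Tri) : 0 < volume.real (M.triSet τ) :=
  ENNReal.toReal_pos
    (Measure.measure_pos_of_nonempty_interior volume (M.interior_triSet_nonempty τ)).ne'
    (M.isCompact_triSet τ).measure_lt_top.ne

theorem eq_zero_of_integral_const_eq_zero {r : ℝ} (τ : M.Tri) (h : M.integral (fun _ _ => r) = 0) :
    r = 0 := by
  simp only [integral, setIntegral_const, smul_eq_mul, ← Finset.sum_mul] at h
  exact (mul_eq_zero.1 h).resolve_left
    (Finset.sum_pos (fun σ _ => M.measureReal_triSet_pos σ) ⟨τ, Finset.mem_univ τ⟩).ne'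

namespace EdgeNormals

variable {M} (N : M.EdgeNormals)

theorem pressure_eq_zero_of_formb (hΩ : interior (closure Ω) = Ω) (hconn : IsPreconnected Ω)
    {k : ℕ} {q : M.ScalarField} (hq : q ∈ M.pressureSpace k)
    (h : ∀ v ∈ N.velocitySpace k, N.formb v q = 0) : q = 0 := by
  obtain ⟨hdeg, hcont, hmean⟩ := hq
  obtain ⟨c, rfl⟩ : ∃ c : M.Tri → ℝ, q = fun τ => MvPolynomial.C (c τ) :=
    ⟨fun τ => MvPolynomial.coeff 0 (q τ), funext fun τ =>
      eq_C_of_pderiv_eq_zero fun j => congrFun (N.grad_eq_zero_of_formb hdeg h τ) j⟩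
  have hconst := M.eq_of_no_jumps hΩ hconn (N.before_eq_after_of_formb h) fun τ τ' hτ hint => by
    simpa only [val_C] using hcont _ hint τ τ' rfl hτ.symm (M.fst τ) (by
      rw [primalEdge, edgeSet_mk]
      exact left_mem_segment ℝ _ _)
  funext τ
  simp only [val_C, hconst _ τ] at hmean
  rw [M.eq_zero_of_integral_const_eq_zero τ hmean, map_zero, Pi.zero_apply]

end EdgeNormals

end Mesh

/-! ### Injectivity of the trace form -/

section Extension

/-- The affine parameter of a segment as a polynomial in the plane. -/
def edgeParamPoly (a b : Plane) : Poly :=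
  ∑ i, ((b i - a i) / ‖b - a‖ ^ 2) • (MvPolynomial.X i - MvPolynomial.C (a i))

theorem aeval_edgeParamPoly (a b x : Plane) :
    MvPolynomial.aeval x.ofLp (edgeParamPoly a b) = edgeParam a b x := by
  simp only [edgeParamPoly, edgeParam, Fin.sum_univ_two, map_add, map_smul, map_sub,
    MvPolynomial.aeval_X, MvPolynomial.aeval_C, Algebra.algebraMap_self_apply, smul_eq_mul,
    PiLp.inner_apply, RCLike.inner_apply, conj_trivial, PiLp.sub_apply]
  ring

/-- The polynomial in the plane that extends a polynomial in the affine parameter of a segment,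
constantly in the normal direction. -/
def extend (a b : Plane) (r : Polynomial ℝ) : Poly := Polynomial.aeval (edgeParamPoly a b) r

theorem val_extend (a b : Plane) (r : Polynomial ℝ) (x : Plane) :
    val (extend a b r) x = r.eval (edgeParam a b x) := by
  rw [← aeval_edgeParamPoly, val, extend, ← MvPolynomial.coe_aeval_eq_eval, RingHom.coe_coe,
    ← Polynomial.aeval_algHom_apply, Polynomial.coe_aeval_eq_eval]

theorem extend_mem {k : ℕ} (a b : Plane) {r : Polynomial ℝ} (hr : r ∈ Polynomial.degreeLE ℝ k) :
    extend a b r ∈ MvPolynomial.restrictTotalDegree (Fin 2) ℝ k := by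
  have hlin : (edgeParamPoly a b).totalDegree ≤ 1 :=
    MvPolynomial.totalDegree_finsetSum_le fun i _ => totalDegree_smul_X_sub_C_le _ _ _
  have hk : r.natDegree ≤ k := Polynomial.natDegree_le_of_degree_le (Polynomial.mem_degreeLE.1 hr)
  rw [MvPolynomial.mem_restrictTotalDegree, extend, Polynomial.aeval_eq_sum_range]
  refine MvPolynomial.totalDegree_finsetSum_le fun i hi => ?_
  calc _ ≤ i * (edgeParamPoly a b).totalDegree :=
        (MvPolynomial.totalDegree_smul_le _ _).trans (MvPolynomial.totalDegree_pow _ _)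
    _ ≤ i * 1 := Nat.mul_le_mul_left i hlin
    _ ≤ k := by have := Finset.mem_range.1 hi; lia

theorem edgeParam_lineMap {a b : Plane} (hab : a ≠ b) (s : ℝ) :
    edgeParam a b (AffineMap.lineMap a b s) = s := by
  have h : ‖b - a‖ ≠ 0 := norm_ne_zero_iff.2 (sub_ne_zero.2 hab.symm)
  rw [edgeParam, AffineMap.lineMap_apply, vsub_eq_sub, vadd_eq_add, add_sub_cancel_right,
    real_inner_smul_left, real_inner_self_eq_norm_sq, mul_div_cancel_right₀ _ (pow_ne_zero 2 h)]

theorem eq_zero_of_eval_edgeParam_eq_zero {a b : Plane} (hab : a ≠ b) {r : Polynomial ℝ}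
    (h : ∀ x ∈ edgeSet s(a, b), r.eval (edgeParam a b x) = 0) : r = 0 := by
  refine Polynomial.eq_zero_of_infinite_isRoot _
    ((Set.Icc_infinite zero_lt_one).mono fun s hs => ?_)
  have hs' := h (AffineMap.lineMap a b s) (by
    rw [edgeSet_mk, segment_eq_image_lineMap]
    exact ⟨s, hs, rfl⟩)
  rwa [edgeParam_lineMap hab] at hs'

end Extension

namespace Mesh

variable {Ω : Set Plane} {M : Mesh Ω}

@[fun_prop]
theorem continuous_eval (w : M.EdgeField) (e : M.DualEdge) : Continuous (M.eval w e) := by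
  refine continuous_pi fun i => (w e i).continuous.comp ?_
  unfold edgeParam
  fun_prop

namespace EdgeNormals

variable (N : M.EdgeNormals)

theorem sub_dotProduct_dual_ne_zero (τ : M.Tri) :
    (M.snd τ - M.fst τ).ofLp ⬝ᵥ N.dual τ ≠ 0 := by
  have h := N.dual_dotProduct_snd_ne_zero τ
  rwa [← sub_add_sub_cancel (M.snd τ) (M.fst τ), WithLp.ofLp_add, dotProduct_add,
    dual_dotProduct_fst, add_zero, dotProduct_comm] at h

/-- The multiple of the direction of the primal edge of a triangle whose flux through the first
dual edge is the sign of that edge in the jump. -/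
def primalDirection (τ : M.Tri) : Fin 2 → ℝ :=
  ((M.normalAfter τ ⬝ᵥ N.dual τ) * ((M.snd τ - M.fst τ).ofLp ⬝ᵥ N.dual τ))⁻¹ •
    (M.snd τ - M.fst τ).ofLp

theorem primalDirection_dotProduct_primal (τ : M.Tri) :
    N.primalDirection τ ⬝ᵥ N.primal (M.primalEdge τ) = 0 := by
  rw [primalDirection, smul_dotProduct, dotProduct_comm _ (N.primal (M.primalEdge τ)),
    (N.primal_isUnitNormal τ).2, smul_zero]

theorem primalDirection_dotProduct_dual (τ : M.Tri) :
    (M.normalAfter τ ⬝ᵥ N.dual τ) * (N.primalDirection τ ⬝ᵥ N.dual τ) = 1 := by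
  rw [primalDirection, smul_dotProduct, smul_eq_mul, mul_left_comm]
  exact inv_mul_cancel₀
    (mul_ne_zero (N.normalAfter_dotProduct_ne_zero τ) (N.sub_dotProduct_dual_ne_zero τ))

/-- The tensor field with magnitude `φ` whose rows are tangential to the primal edge of every
triangle and whose fluxes are normal to the second dual edge, so that it does
no work on the trace there and tests the trace on the first dual edge alone. -/
def tangentialTensor (φ : M.Tri → Poly) : M.TensorField :=
  fun τ => Matrix.of fun i j => (N.dual (M.next τ) i * N.primalDirection τ j) • φ τ

theorem mval_tangentialTensor_mulVec (φ : M.Tri → Poly) (τ : M.Tri) (x : Plane) (m : Fin 2 → ℝ) :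
    mval (N.tangentialTensor φ τ) x *ᵥ m =
      (val (φ τ) x * (N.primalDirection τ ⬝ᵥ m)) • N.dual (M.next τ) := by
  funext i
  simp only [mval, tangentialTensor, mulVec, dotProduct, Fin.sum_univ_two, of_apply, val_smul,
    Pi.smul_apply, smul_eq_mul]
  ring

theorem tangentialTensor_mem {k : ℕ} {φ : M.Tri → Poly}
    (hφ : ∀ τ, φ τ ∈ MvPolynomial.restrictTotalDegree (Fin 2) ℝ k) :
    N.tangentialTensor φ ∈ N.gradientSpace k := by
  refine ⟨fun τ i j => Submodule.smul_mem _ _ (hφ τ), ?_⟩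
  have hzero : ∀ τ x, mval (N.tangentialTensor φ τ) x *ᵥ N.primal (M.primalEdge τ) = 0 :=
    fun τ x => by
      rw [mval_tangentialTensor_mulVec, primalDirection_dotProduct_primal, mul_zero, zero_smul]
  rintro e - τ τ' rfl hτ' x -
  rw [hzero, ← hτ', hzero]

theorem dotProduct_jumpDual_tangentialTensor (φ : M.Tri → Poly) {e : M.DualEdge}
    {w : Fin 2 → ℝ} (hw : w ⬝ᵥ N.dual e = 0) (x : Plane) :
    w ⬝ᵥ N.jumpDual (fun τ => mval (N.tangentialTensor φ τ) x *ᵥ N.dual e) e =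
      val (φ e) x * (w ⬝ᵥ N.dual (M.next e)) := by
  rw [jumpDual, mval_tangentialTensor_mulVec, mval_tangentialTensor_mulVec, next_before,
    after]
  simp only [dotProduct_add, dotProduct_smul, smul_eq_mul]
  linear_combination
    (val (φ e) x * (w ⬝ᵥ N.dual (M.next e))) * N.primalDirection_dotProduct_dual e +
    (M.normalBefore e ⬝ᵥ N.dual e) * val (φ (M.before e)) x *
      (N.primalDirection (M.before e) ⬝ᵥ N.dual e) * hw

theorem eval_dotProduct_dual_next_eq_zero_of_formTstar {k : ℕ} {w : M.EdgeField}
    (hw : w ∈ N.traceSpace k) (h : ∀ G ∈ N.gradientSpace k, N.formTstar w G = 0) {e : M.DualEdge}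
    {x : Plane} (hx : x ∈ edgeSet (M.dualSym e)) : M.eval w e x ⬝ᵥ N.dual (M.next e) = 0 := by
  set φ : M.Tri → Poly := fun τ =>
    ∑ i, N.dual (M.next τ) i • extend (M.center τ.1) (M.vertex τ.1 τ.2) (w τ i)
  have hval : ∀ τ x, val (φ τ) x = M.eval w τ x ⬝ᵥ N.dual (M.next τ) := fun τ x => by
    simp only [φ, val_sum, val_smul, val_extend, Mesh.eval, dotProduct, mul_comm]
  have hφ : N.tangentialTensor φ ∈ N.gradientSpace k := N.tangentialTensor_mem fun τ =>
    Submodule.sum_mem _ fun i _ => Submodule.smul_mem _ _ (extend_mem _ _ (hw.1 τ i))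
  have hsq : M.dualIntegral (fun e x => (M.eval w e x ⬝ᵥ N.dual (M.next e)) ^ 2) = 0 := by
    rw [← h _ hφ]
    refine M.dualIntegral_congr fun e x hx => ?_
    rw [dotProduct_jumpDual_tangentialTensor _ _ (hw.2 e x hx), hval, pow_two]
  exact pow_eq_zero_iff two_ne_zero |>.1 <|
    M.eq_zero_of_dualIntegral_eq_zero (fun e => by fun_prop) (fun _ _ => sq_nonneg _) hsq hx

theorem trace_eq_zero_of_formTstar {k : ℕ} {w : M.EdgeField} (hw : w ∈ N.traceSpace k)
    (h : ∀ G ∈ N.gradientSpace k, N.formTstar w G = 0) : w = 0 := by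
  funext e i
  refine eq_zero_of_eval_edgeParam_eq_zero (M.center_ne_vertex e) fun x hx => ?_
  have hzero : M.eval w e x = 0 := (N.dual_isUnitNormal e).eq_zero_of_dotProduct_eq_zero
    (M.triDet_center_ne_zero e) (N.dual_isUnitNormal (M.next e)) (hw.2 e x hx)
    (N.eval_dotProduct_dual_next_eq_zero_of_formTstar hw h hx)
  exact congrFun hzero i

end EdgeNormals

end Mesh

/-! ### Saddle point systems -/

section SaddlePoint

open Module

variable {𝕜 W U T P : Type*} [Field 𝕜]
  [AddCommGroup W] [Module 𝕜 W] [AddCommGroup U] [Module 𝕜 U]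
  [AddCommGroup T] [Module 𝕜 T] [AddCommGroup P] [Module 𝕜 P]

/-- The operator of the saddle point system for an unknown `(L, u, w, p)`, where `B` and `C`
couple `L` to the multipliers `u` and `w`, and `b` couples `u` to the multiplier `p`. -/
def saddleOperator (a : W →ₗ[𝕜] Dual 𝕜 W) (m : U →ₗ[𝕜] Dual 𝕜 U) (B : U →ₗ[𝕜] Dual 𝕜 W)
    (C : T →ₗ[𝕜] Dual 𝕜 W) (b : U →ₗ[𝕜] Dual 𝕜 P) :
    W × U × T × P →ₗ[𝕜] Dual 𝕜 W × Dual 𝕜 U × Dual 𝕜 T × Dual 𝕜 P where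
  toFun s := (a s.1 - B s.2.1 - C s.2.2.1, B.flip s.1 + m s.2.1 + b.flip s.2.2.2, C.flip s.1,
    -b s.2.1)
  map_add' s t := by
    simp only [Prod.fst_add, Prod.snd_add, map_add, Prod.mk_add_mk, Prod.mk.injEq]
    refine ⟨?_, ?_, trivial, ?_⟩ <;> abel
  map_smul' r s := by
    simp only [Prod.smul_fst, Prod.smul_snd, map_smul, smul_add, smul_sub, smul_neg, Prod.smul_mk,
      RingHom.id_apply]

variable {a : W →ₗ[𝕜] Dual 𝕜 W} {m : U →ₗ[𝕜] Dual 𝕜 U} {B : U →ₗ[𝕜] Dual 𝕜 W}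
  {C : T →ₗ[𝕜] Dual 𝕜 W} {b : U →ₗ[𝕜] Dual 𝕜 P}

theorem saddleOperator_eq_iff {s : W × U × T × P} {f : Dual 𝕜 U} {g : Dual 𝕜 P} :
    saddleOperator a m B C b s = (0, f, 0, g) ↔
      (∀ G, a s.1 G = B s.2.1 G + C s.2.2.1 G) ∧
      (∀ v, B v s.1 + m s.2.1 v + b v s.2.2.2 = f v) ∧
      (∀ q, -b s.2.1 q = g q) ∧ ∀ z, C z s.1 = 0 := by
  have hgrad : a s.1 - B s.2.1 - C s.2.2.1 = 0 ↔ ∀ G, a s.1 G = B s.2.1 G + C s.2.2.1 G := by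
    rw [sub_sub, sub_eq_zero]
    exact LinearMap.ext_iff
  rw [← hgrad]
  simp only [saddleOperator, LinearMap.coe_mk, AddHom.coe_mk, Prod.mk.injEq, LinearMap.ext_iff,
    LinearMap.add_apply, LinearMap.neg_apply, LinearMap.flip_apply, LinearMap.zero_apply]
  tauto

variable [LinearOrder 𝕜] [IsStrictOrderedRing 𝕜]

/-- Testing the homogeneous system with its own solution gives `a L L + m u u = 0`. -/
theorem saddleOperator_injective (ha : ∀ L ≠ 0, 0 < a L L) (hm : ∀ u ≠ 0, 0 < m u u)
    (hC : Function.Injective C) (hb : Function.Injective b.flip) :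
    Function.Injective (saddleOperator a m B C b) := by
  refine (injective_iff_map_eq_zero _).2 ?_
  rintro ⟨L, u, w, p⟩ hs
  obtain ⟨hgrad, hmom, hmass, htrace⟩ := saddleOperator_eq_iff.1 hs
  simp only [LinearMap.zero_apply] at hmom hmass
  have henergy : a L L + m u u = 0 := by
    linear_combination hgrad L + hmom u + hmass p + htrace w
  have hL : L = 0 := by
    by_contra hL
    have hu : 0 ≤ m u u := by
      rcases eq_or_ne u 0 with rfl | hu
      · simp
      · exact (hm u hu).le
    exact (add_pos_of_pos_of_nonneg (ha L hL) hu).ne' henergy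
  subst hL
  have hu : u = 0 := by
    by_contra hu
    exact (hm u hu).ne' (by simpa using henergy)
  subst hu
  have hw : w = 0 := (injective_iff_map_eq_zero C).1 hC w <| LinearMap.ext fun G => by
    simpa using (hgrad G).symm
  have hp : p = 0 := (injective_iff_map_eq_zero b.flip).1 hb p <| LinearMap.ext fun v => by
    simpa using hmom v
  rw [hw, hp]
  rfl

theorem existsUnique_saddlePoint [FiniteDimensional 𝕜 W] [FiniteDimensional 𝕜 U]
    [FiniteDimensional 𝕜 T] [FiniteDimensional 𝕜 P] (ha : ∀ L ≠ 0, 0 < a L L)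
    (hm : ∀ u ≠ 0, 0 < m u u) (hC : Function.Injective C) (hb : Function.Injective b.flip)
    (f : Dual 𝕜 U) (g : Dual 𝕜 P) :
    ∃! s : W × U × T × P, (∀ G, a s.1 G = B s.2.1 G + C s.2.2.1 G) ∧
      (∀ v, B v s.1 + m s.2.1 v + b v s.2.2.2 = f v) ∧
      (∀ q, -b s.2.1 q = g q) ∧ ∀ z, C z s.1 = 0 := by
  have hinj := saddleOperator_injective (B := B) ha hm hC hb
  have hsurj := (LinearMap.injective_iff_surjective_of_finrank_eq_finrank
    (by simp only [finrank_prod, Subspace.dual_finrank_eq])).1 hinj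
  simpa only [saddleOperator_eq_iff] using
    Function.Bijective.existsUnique ⟨hinj, hsurj⟩ ((0, f, 0, g) : _ × _ × _ × _)

end SaddlePoint

/-! ### The discrete system -/

theorem mdvg_add (G H : Matrix (Fin 2) (Fin 2) Poly) : mdvg (G + H) = mdvg G + mdvg H := by
  funext i
  simp [mdvg, Finset.sum_add_distrib]

theorem mdvg_smul (r : ℝ) (G : Matrix (Fin 2) (Fin 2) Poly) : mdvg (r • G) = r • mdvg G := by
  funext i
  simp [mdvg]

theorem grad_add (p q : Poly) : grad (p + q) = grad p + grad q := by
  funext i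
  simp [grad]

theorem grad_smul (r : ℝ) (p : Poly) : grad (r • p) = r • grad p := by
  funext i
  simp [grad]

instance finiteDimensional_pi {𝕜 ι : Type*} [DivisionRing 𝕜] [Finite ι] {V : ι → Type*}
    [∀ i, AddCommGroup (V i)] [∀ i, Module 𝕜 (V i)] (S : ∀ i, Submodule 𝕜 (V i))
    [∀ i, FiniteDimensional 𝕜 (S i)] : FiniteDimensional 𝕜 (Submodule.pi Set.univ S) :=
  Module.Finite.iff_fg.2 (Submodule.fg_pi fun _ => Module.Finite.iff_fg.1 inferInstance)

instance finiteDimensional_degreeLE {𝕜 : Type*} [Field 𝕜] (k : ℕ) :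
    FiniteDimensional 𝕜 (Polynomial.degreeLE 𝕜 k) := by
  classical
  rw [Polynomial.degreeLE_eq_span_X_pow]
  exact Module.Finite.span_finset 𝕜 _

namespace Mesh

variable {Ω : Set Plane} (M : Mesh Ω)

instance finiteDimensional_pressureSpace (k : ℕ) : FiniteDimensional ℝ (M.pressureSpace k) :=
  Submodule.finiteDimensional_of_le (S₂ := Submodule.pi Set.univ fun _ : M.Tri =>
    MvPolynomial.restrictTotalDegree (Fin 2) ℝ k) fun _ h τ _ => h.1 τ

theorem eval_add (w z : M.EdgeField) (e : M.DualEdge) (x : Plane) :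
    M.eval (w + z) e x = M.eval w e x + M.eval z e x := by
  funext i
  simp [eval]

theorem eval_smul (r : ℝ) (w : M.EdgeField) (e : M.DualEdge) (x : Plane) :
    M.eval (r • w) e x = r • M.eval w e x := by
  funext i
  simp [eval]

section Bilinear

variable {X Y : Type*} [AddCommGroup X] [Module ℝ X] [AddCommGroup Y] [Module ℝ Y]

theorem isLinearMap_integral {φ : M.Tri → Plane → X → ℝ} (hφ : ∀ τ x, IsLinearMap ℝ (φ τ x))
    (hint : ∀ τ u, IntegrableOn (fun x => φ τ x u) (M.triSet τ)) :
    IsLinearMap ℝ fun u => M.integral fun τ x => φ τ x u where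
  map_add u v := by
    simp only [(hφ _ _).map_add]
    exact M.integral_add (fun τ => hint τ u) fun τ => hint τ v
  map_smul r u := by
    simp only [(hφ _ _).map_smul]
    exact M.integral_const_mul r _

theorem isBilinearMap_integral {φ : M.Tri → Plane → X → Y → ℝ}
    (hφ : ∀ τ x, IsBilinearMap ℝ (φ τ x))
    (hint : ∀ τ u v, IntegrableOn (fun x => φ τ x u v) (M.triSet τ)) :
    IsBilinearMap ℝ fun u v => M.integral fun τ x => φ τ x u v where
  add_left u u' v := (M.isLinearMap_integral (fun τ x => ⟨((hφ τ x).add_left · · v),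
    ((hφ τ x).smul_left · · v)⟩) fun τ u => hint τ u v).map_add u u'
  smul_left r u v := (M.isLinearMap_integral (fun τ x => ⟨((hφ τ x).add_left · · v),
    ((hφ τ x).smul_left · · v)⟩) fun τ u => hint τ u v).map_smul r u
  add_right u := (M.isLinearMap_integral (fun τ x => ⟨(hφ τ x).add_right u,
    ((hφ τ x).smul_right · u)⟩) fun τ => hint τ u).map_add
  smul_right r u := (M.isLinearMap_integral (fun τ x => ⟨(hφ τ x).add_right u,
    ((hφ τ x).smul_right · u)⟩) fun τ => hint τ u).map_smul r

theorem isBilinearMap_dualIntegral {φ : M.DualEdge → Plane → X → Y → ℝ}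
    (hφ : ∀ e x, IsBilinearMap ℝ (φ e x)) (hcont : ∀ e u v, Continuous fun x => φ e x u v) :
    IsBilinearMap ℝ fun u v => M.dualIntegral fun e x => φ e x u v where
  add_left u u' v := by
    simp only [(hφ _ _).add_left]
    exact M.dualIntegral_add (fun e => hcont e u v) fun e => hcont e u' v
  smul_left r u v := by
    simp only [(hφ _ _).smul_left]
    exact M.dualIntegral_const_mul r _
  add_right u v v' := by
    simp only [(hφ _ _).add_right]
    exact M.dualIntegral_add (fun e => hcont e u v) fun e => hcont e u v'
  smul_right r u v := by
    simp only [(hφ _ _).smul_right]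
    exact M.dualIntegral_const_mul r _

end Bilinear

/-- The inner product `(L, G)` of tensor fields. -/
def tensorInner : M.TensorField →ₗ[ℝ] M.TensorField →ₗ[ℝ] ℝ :=
  IsBilinearMap.toLinearMap (f := fun L G : M.TensorField =>
    M.integral fun τ x => ddot (mval (L τ) x) (mval (G τ) x)) <|
  M.isBilinearMap_integral (fun τ x => by
    constructor <;> intros <;> simp only [Pi.add_apply, Pi.smul_apply, mval_add, mval_smul, ddot,
      Matrix.add_apply, Matrix.smul_apply, smul_eq_mul, Fin.sum_univ_two] <;> ring)
    fun τ L G => M.integrableOn_triSet (by fun_prop) τ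

/-- The weighted inner product `(α u, v)` of vector fields. -/
def weightedInner {α : Plane → ℝ} (hα : ∀ τ, IntegrableOn α (M.triSet τ)) :
    M.VectorField →ₗ[ℝ] M.VectorField →ₗ[ℝ] ℝ :=
  IsBilinearMap.toLinearMap (f := fun u v : M.VectorField =>
    M.integral fun τ x => (α x • vval (u τ) x) ⬝ᵥ vval (v τ) x) <|
  M.isBilinearMap_integral (fun τ x => by
    constructor <;> intros <;> simp only [Pi.add_apply, Pi.smul_apply, vval_add, vval_smul,
      smul_dotProduct, dotProduct_smul, add_dotProduct, dotProduct_add, smul_eq_mul] <;> ring)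
    fun τ u v => by
      simp only [smul_dotProduct, smul_eq_mul]
      exact (hα τ).mul_continuousOn (Continuous.continuousOn (by fun_prop)) (M.isCompact_triSet τ)

/-- The functional `v ↦ (f, v)`. -/
def vectorLoad {f : Plane → Fin 2 → ℝ} (hf : ∀ τ i, IntegrableOn (fun x => f x i) (M.triSet τ)) :
    M.VectorField →ₗ[ℝ] ℝ :=
  IsLinearMap.mk' (fun v : M.VectorField => M.integral fun τ x => f x ⬝ᵥ vval (v τ) x) <|
  M.isLinearMap_integral (fun τ x => by
    constructor <;> intros <;> simp only [Pi.add_apply, Pi.smul_apply, vval_add, vval_smul,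
      dotProduct_smul, dotProduct_add])
    fun τ v => integrable_finsetSum _ fun i _ =>
      (hf τ i).mul_continuousOn (continuous_val _).continuousOn (M.isCompact_triSet τ)

/-- The functional `q ↦ (g, q)`. -/
def scalarLoad {g : Plane → ℝ} (hg : ∀ τ, IntegrableOn g (M.triSet τ)) :
    M.ScalarField →ₗ[ℝ] ℝ :=
  IsLinearMap.mk' (fun q : M.ScalarField => M.integral fun τ x => g x * val (q τ) x) <|
  M.isLinearMap_integral (fun τ x => by
    constructor <;> intros <;> simp only [Pi.add_apply, Pi.smul_apply, val_add, val_smul,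
      smul_eq_mul] <;> ring)
    fun τ q => (hg τ).mul_continuousOn (continuous_val _).continuousOn (M.isCompact_triSet τ)

namespace EdgeNormals

variable {M} (N : M.EdgeNormals)

instance finiteDimensional_velocitySpace (k : ℕ) : FiniteDimensional ℝ (N.velocitySpace k) :=
  Submodule.finiteDimensional_of_le (S₂ := Submodule.pi Set.univ fun _ : M.Tri =>
    Submodule.pi Set.univ fun _ : Fin 2 => MvPolynomial.restrictTotalDegree (Fin 2) ℝ k)
    fun _ h τ _ i _ => h.1 τ i

instance finiteDimensional_gradientSpace (k : ℕ) : FiniteDimensional ℝ (N.gradientSpace k) :=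
  let components : N.gradientSpace k →ₗ[ℝ]
      (M.Tri → Fin 2 → Fin 2 → MvPolynomial.restrictTotalDegree (Fin 2) ℝ k) :=
    { toFun := fun G τ i j => ⟨G.1 τ i j, G.2.1 τ i j⟩
      map_add' := fun _ _ => rfl
      map_smul' := fun _ _ => rfl }
  Module.Finite.of_injective components fun _ _ h => Subtype.ext <| funext fun τ =>
    Matrix.ext fun i j => congrArg (fun F => (F τ i j : Poly)) h

instance finiteDimensional_traceSpace (k : ℕ) : FiniteDimensional ℝ (N.traceSpace k) :=
  Submodule.finiteDimensional_of_le (S₂ := Submodule.pi Set.univ fun _ : M.DualEdge =>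
    Submodule.pi Set.univ fun _ : Fin 2 => Polynomial.degreeLE ℝ k)
    fun _ h e _ i _ => h.1 e i

/-- `B_h^*` as a bilinear map. -/
def bilinBstar : M.VectorField →ₗ[ℝ] M.TensorField →ₗ[ℝ] ℝ :=
  -IsBilinearMap.toLinearMap (M.isBilinearMap_integral
    (φ := fun τ x (v : M.VectorField) (G : M.TensorField) =>
      vval (v τ) x ⬝ᵥ vval (mdvg (G τ)) x)
    (fun τ x => by
      constructor <;> intros <;> simp only [Pi.add_apply, Pi.smul_apply, mdvg_add, mdvg_smul,
        vval_add, vval_smul, smul_dotProduct, dotProduct_smul, add_dotProduct, dotProduct_add])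
    fun τ v G => M.integrableOn_triSet (by fun_prop) τ) +
  IsBilinearMap.toLinearMap (M.isBilinearMap_dualIntegral
    (φ := fun e x (v : M.VectorField) (G : M.TensorField) =>
      (vval (v (M.after e)) x ⬝ᵥ N.dual e) *
        (N.dual e ⬝ᵥ N.jumpDual (fun τ => mval (G τ) x *ᵥ N.dual e) e))
    (fun e x => by
      constructor <;> intros <;> simp only [Pi.add_apply, Pi.smul_apply, vval_add, vval_smul,
        mval_add, mval_smul, add_mulVec, smul_mulVec, jumpDual_add, jumpDual_smul,
        smul_dotProduct, dotProduct_smul, add_dotProduct, dotProduct_add, smul_eq_mul] <;> ring)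
    fun e v G => by fun_prop)

/-- `T_h^*` as a bilinear map. -/
def bilinTstar : M.EdgeField →ₗ[ℝ] M.TensorField →ₗ[ℝ] ℝ :=
  IsBilinearMap.toLinearMap (M.isBilinearMap_dualIntegral
    (φ := fun e x (w : M.EdgeField) (G : M.TensorField) =>
      M.eval w e x ⬝ᵥ N.jumpDual (fun τ => mval (G τ) x *ᵥ N.dual e) e)
    (fun e x => by
      constructor <;> intros <;> simp only [Pi.add_apply, Pi.smul_apply, eval_add, eval_smul,
        mval_add, mval_smul, add_mulVec, smul_mulVec, jumpDual_add, jumpDual_smul,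
        smul_dotProduct, dotProduct_smul, add_dotProduct, dotProduct_add])
    fun e w G => by fun_prop)

/-- `b_h` as a bilinear map. -/
def bilinb : M.VectorField →ₗ[ℝ] M.ScalarField →ₗ[ℝ] ℝ :=
  IsBilinearMap.toLinearMap (M.isBilinearMap_integral
    (φ := fun τ x (v : M.VectorField) (q : M.ScalarField) =>
      vval (v τ) x ⬝ᵥ vval (grad (q τ)) x)
    (fun τ x => by
      constructor <;> intros <;> simp only [Pi.add_apply, Pi.smul_apply, grad_add, grad_smul,
        vval_add, vval_smul, smul_dotProduct, dotProduct_smul, add_dotProduct, dotProduct_add])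
    fun τ v q => M.integrableOn_triSet (by fun_prop) τ) -
  IsBilinearMap.toLinearMap (M.isBilinearMap_dualIntegral
    (φ := fun e x (v : M.VectorField) (q : M.ScalarField) =>
      (vval (v (M.after e)) x ⬝ᵥ N.dual e) * N.jumpDual (fun τ => val (q τ) x) e)
    (fun e x => by
      constructor <;> intros <;> simp only [Pi.add_apply, Pi.smul_apply, vval_add, vval_smul,
        val_add, val_smul, ← smul_eq_mul, jumpDual_add, jumpDual_smul,
        smul_dotProduct, add_dotProduct] <;> module)
    fun e v q => by fun_prop)

end EdgeNormals
end Mesh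

namespace Mesh

variable {Ω : Set Plane} (M : Mesh Ω)

theorem restrict_triSet_le (hΩ : interior (closure Ω) = Ω) (τ : M.Tri) :
    volume.restrict (M.triSet τ) ≤ volume.restrict Ω := by
  have h : volume (frontier (M.triSet τ)) = 0 := (convex_convexHull ℝ _).addHaar_frontier volume
  rw [← Measure.restrict_congr_set (interior_ae_eq_of_null_frontier h)]
  exact Measure.restrict_mono (M.interior_triSet_subset hΩ τ) le_rfl

theorem integral_nonneg {φ : M.Tri → Plane → ℝ}
    (h : ∀ τ, 0 ≤ᵐ[volume.restrict (M.triSet τ)] φ τ) : 0 ≤ M.integral φ :=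
  Finset.sum_nonneg fun τ _ => integral_nonneg_of_ae (h τ)

theorem integral_mul_sum_self_pos {ι : Type*} [Fintype ι] {w : Plane → ℝ}
    (hw : ∀ τ, IntegrableOn w (M.triSet τ))
    (hpos : ∀ τ, ∀ᵐ x ∂volume.restrict (M.triSet τ), 0 < w x) {p : M.Tri → ι → Poly}
    (hp : p ≠ 0) : 0 < M.integral fun τ x => w x * ∑ i, (val (p τ i) x * val (p τ i) x) := by
  refine lt_of_le_of_ne (M.integral_nonneg fun τ => ?_) fun h => hp ?_
  · filter_upwards [hpos τ] with x hx
    exact mul_nonneg hx.le (Finset.sum_nonneg fun i _ => mul_self_nonneg _)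
  · have hsq : ∀ τ i, p τ i * p τ i = 0 :=
      M.poly_eq_zero_of_integral_sum_eq_zero hw hpos
        (fun τ i x _ => by simpa only [val_mul] using mul_self_nonneg _)
        (by simpa only [val_mul] using h.symm)
    exact funext fun τ => funext fun i => mul_self_eq_zero.1 (hsq τ i)

theorem tensorInner_self_pos {L : M.TensorField} (hL : L ≠ 0) : 0 < M.tensorInner L L := by
  have hp : (fun τ (ij : Fin 2 × Fin 2) => L τ ij.1 ij.2) ≠ 0 := fun h => hL <|
    funext fun τ => Matrix.ext fun i j => congrFun (congrFun h τ) (i, j)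
  have h := M.integral_mul_sum_self_pos (w := fun _ => 1)
    (fun τ => continuousOn_const.integrableOn_compact (M.isCompact_triSet τ)) (by simp) hp
  simp only [one_mul, Fintype.sum_prod_type] at h
  exact h

theorem weightedInner_self_pos {α : Plane → ℝ} (hα : ∀ τ, IntegrableOn α (M.triSet τ))
    (hpos : ∀ τ, ∀ᵐ x ∂volume.restrict (M.triSet τ), 0 < α x) {u : M.VectorField} (hu : u ≠ 0) :
    0 < M.weightedInner hα u u := by
  change 0 < M.integral fun τ x => (α x • vval (u τ) x) ⬝ᵥ vval (u τ) x
  simp only [smul_dotProduct]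
  exact M.integral_mul_sum_self_pos hα hpos hu

namespace EdgeNormals

variable {M} (N : M.EdgeNormals) {k : ℕ} {ε : ℝ} {α : Plane → ℝ} {f : Plane → Fin 2 → ℝ}
  {g : Plane → ℝ}

theorem isSolution_iff (hε : 0 < ε) (hα : ∀ τ, IntegrableOn α (M.triSet τ))
    (hf : ∀ τ i, IntegrableOn (fun x => f x i) (M.triSet τ))
    (hg : ∀ τ, IntegrableOn g (M.triSet τ)) (L : N.gradientSpace k) (u : N.velocitySpace k)
    (w : N.traceSpace k) (p : M.pressureSpace k) :
    N.IsSolution k ε α f g L u w p ↔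
      (∀ G : N.gradientSpace k, M.tensorInner L.1 G.1 =
        √ε * N.bilinBstar u.1 G.1 + √ε * N.bilinTstar w.1 G.1) ∧
      (∀ v : N.velocitySpace k, √ε * N.bilinBstar v.1 L.1 + M.weightedInner hα u.1 v.1 +
        N.bilinb v.1 p.1 = M.vectorLoad hf v.1) ∧
      (∀ q : M.pressureSpace k, -N.bilinb u.1 q.1 = M.scalarLoad hg q.1) ∧
      ∀ z : N.traceSpace k, √ε * N.bilinTstar z.1 L.1 = 0 := by
  have hsqrt : √ε ≠ 0 := (Real.sqrt_pos.2 hε).ne'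
  have hB (v : N.velocitySpace k) : N.formB L v = N.bilinBstar v.1 L.1 :=
    N.formB_eq_formBstar v.2 L.2
  have hb (v : N.velocitySpace k) : N.formbstar p v = N.bilinb v.1 p.1 :=
    N.formbstar_eq_formb v.2 p.2
  have hT (z : N.traceSpace k) : N.formT L z = N.bilinTstar z.1 L.1 := N.formT_eq_formTstar ..
  simp only [mul_eq_zero, hsqrt, false_or]
  constructor
  · rintro ⟨hgrad, hmom, hmass, htrace⟩
    exact ⟨hgrad, fun v => by rw [← hB, ← hb]; exact hmom v, hmass,
      fun z => (hT z).symm.trans (htrace z)⟩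
  · rintro ⟨hgrad, hmom, hmass, htrace⟩
    exact ⟨hgrad, fun v => by rw [hB, hb]; exact hmom v, hmass,
      fun z => (hT z).trans (htrace z)⟩

end EdgeNormals
end Mesh

end SDG

end

theorem theorem3p2_general (Ω : Set SDG.Plane) (hΩ : interior (closure Ω) = Ω)
    (hconn : IsPreconnected Ω) (M : SDG.Mesh Ω) (N : M.EdgeNormals) (k : ℕ) (ε : ℝ) (hε : 0 < ε)
    (α : SDG.Plane → ℝ) (hα : IntegrableOn α Ω) (hpos : ∀ᵐ x ∂volume.restrict Ω, 0 < α x)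
    (f : SDG.Plane → Fin 2 → ℝ) (hf : ∀ i, IntegrableOn (fun x => f x i) Ω)
    (g : SDG.Plane → ℝ) (hg : IntegrableOn g Ω) :
    ∃! s : N.gradientSpace k × N.velocitySpace k × N.traceSpace k × M.pressureSpace k,
      N.IsSolution k ε α f g s.1 s.2.1 s.2.2.1 s.2.2.2 := by
  have hle := M.restrict_triSet_le hΩ
  have hα' (τ) : IntegrableOn α (M.triSet τ) := Integrable.mono_measure hα (hle τ)
  have hpos' (τ) : ∀ᵐ x ∂volume.restrict (M.triSet τ), 0 < α x := ae_mono (hle τ) hpos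
  have hf' (τ) (i) : IntegrableOn (fun x => f x i) (M.triSet τ) :=
    Integrable.mono_measure (hf i) (hle τ)
  have hg' (τ) : IntegrableOn g (M.triSet τ) := Integrable.mono_measure hg (hle τ)
  have hsqrt : √ε ≠ 0 := (Real.sqrt_pos.2 hε).ne'
  simp only [N.isSolution_iff hε hα' hf' hg']
  refine SDG.existsUnique_saddlePoint
    (a := M.tensorInner.domRestrict₁₂ (N.gradientSpace k) (N.gradientSpace k))
    (m := (M.weightedInner hα').domRestrict₁₂ (N.velocitySpace k) (N.velocitySpace k))
    (B := √ε • N.bilinBstar.domRestrict₁₂ (N.velocitySpace k) (N.gradientSpace k))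
    (C := √ε • N.bilinTstar.domRestrict₁₂ (N.traceSpace k) (N.gradientSpace k))
    (b := N.bilinb.domRestrict₁₂ (N.velocitySpace k) (M.pressureSpace k))
    (fun L hL => M.tensorInner_self_pos fun h => hL (Subtype.ext h))
    (fun u hu => M.weightedInner_self_pos hα' hpos' fun h => hu (Subtype.ext h)) ?_ ?_
    ((M.vectorLoad hf').domRestrict _) ((M.scalarLoad hg').domRestrict _)
  · refine (injective_iff_map_eq_zero _).2 fun w hw => Subtype.ext ?_
    refine N.trace_eq_zero_of_formTstar w.2 fun G hG => ?_
    exact (mul_eq_zero_iff_left hsqrt).1 (LinearMap.congr_fun hw ⟨G, hG⟩)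
  · refine (injective_iff_map_eq_zero _).2 fun q hq => Subtype.ext ?_
    exact N.pressure_eq_zero_of_formb hΩ hconn q.2 fun v hv => LinearMap.congr_fun hq ⟨v, hv⟩

theorem theorem3p2 (Ω : Set SDG.Plane) (hΩ : SDG.IsPolygonalDomain Ω)
    (M : SDG.Mesh Ω) (N : M.EdgeNormals) (k : ℕ)
    (ε : ℝ) (hε : 0 < ε)
    (α : SDG.Plane → ℝ) (αmin αmax : ℝ) (hαmin : 0 < αmin)
    (hαm : AEStronglyMeasurable α (volume.restrict Ω))
    (hα : ∀ᵐ x ∂volume.restrict Ω, αmin ≤ α x ∧ α x ≤ αmax)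
    (f : SDG.Plane → Fin 2 → ℝ) (hf : ∀ i, MemLp (fun x => f x i) 2 (volume.restrict Ω))
    (g : SDG.Plane → ℝ) (hg : MemLp g 2 (volume.restrict Ω)) :
    ∃! s : N.gradientSpace k × N.velocitySpace k × N.traceSpace k × M.pressureSpace k,
      N.IsSolution k ε α f g s.1 s.2.1 s.2.2.1 s.2.2.2 :=
  have : IsFiniteMeasure (volume.restrict Ω) :=
    isFiniteMeasure_restrict.2 hΩ.isBounded.measure_lt_top.ne
  theorem3p2_general Ω hΩ.interior_closure hΩ.isConnected.isPreconnected M N k ε hε α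
    (Integrable.of_mem_Icc αmin αmax hαm.aemeasurable hα)
    (hα.mono fun _ hx => hαmin.trans_le hx.1) f (fun i => (hf i).integrable one_le_two)
    g (hg.integrable one_le_two)
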